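/- Let $n=2m\ge 2$ be an even integer, let $g_0$ be the Euclidean metric on $\mathbb{R}^n$, let $w\in C^\infty(\mathbb{R}^n)$ be real-valued, and let $g=e^{2w}g_0$. Let $R_g$ be the scalar curvature and $dv_g=e^{nw}\,dx$ the volume measure of $g$, and let $$Q_g=e^{-nw}(-\Delta)^m w,\qquad \Delta=\sum_{i=1}^n\partial_i^2,$$ be the ($n$-th order) $Q$-curvature of $g$. Assume that (A1) $g$ is complete; (A2) $R_g\ge 0$ outside some compact subset of $\mathbb{R}^n$; (A3) $\int_{\mathbb{R}^n}|Q_g|\,dv_g<\infty$. Then $$C_n\int_{\mathbb{R}^n}Q_g\,dv_g\le 1,\qquad C_n=\frac{1}{((n-2)!!)^2\,|S^{n-1}|},$$ where $(2k)!!=(2k)(2k-2)\cdots 2$, $0!!=1$, and $|S^{n-1}|$ is the volume of the unit sphere in $\mathbb{R}^n$. -/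

import Mathlib

open MeasureTheory Filter Topology
open scoped ContDiff Manifold ENNReal

noncomputable section

/-- Euclidean space `ℝⁿ`. -/
abbrev Euc (n : ℕ) : Type := EuclideanSpace ℝ (Fin n)

/-- A field of `n × n` matrices `g = (g_ij)` on `ℝⁿ`: the components of a metric tensor in the
standard coordinates. -/
abbrev MetricField (n : ℕ) : Type := Euc n → Matrix (Fin n) (Fin n) ℝ

namespace MetricField

variable {n : ℕ}

/-- The coordinate partial derivative `∂_i f`. -/
def pd (i : Fin n) (f : Euc n → ℝ) (x : Euc n) : ℝ :=
  fderiv ℝ f x (EuclideanSpace.single i 1)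

/-- Christoffel symbols
`Γ^k_ij = (1/2) ∑_l g^{kl} (∂_i g_jl + ∂_j g_il - ∂_l g_ij)`. -/
def christoffel (g : MetricField n) (k i j : Fin n) (x : Euc n) : ℝ :=
  (1 / 2) * ∑ l, (g x)⁻¹ k l *
    (pd i (fun y => g y j l) x + pd j (fun y => g y i l) x - pd l (fun y => g y i j) x)

/-- Ricci curvature
`Ric_ij = ∑_k (∂_k Γ^k_ij - ∂_j Γ^k_ik) + ∑_{k,l} (Γ^k_kl Γ^l_ij - Γ^k_jl Γ^l_ik)`
(positive on round spheres). -/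
def ricci (g : MetricField n) (i j : Fin n) (x : Euc n) : ℝ :=
  ∑ k, (pd k (christoffel g k i j) x - pd j (christoffel g k i k) x) +
    ∑ k, ∑ l, (christoffel g k k l x * christoffel g l i j x -
      christoffel g k j l x * christoffel g l i k x)

/-- Scalar curvature `R_g = ∑_{i,j} g^{ij} Ric_ij`. -/
def scalarCurvature (g : MetricField n) (x : Euc n) : ℝ :=
  ∑ i, ∑ j, (g x)⁻¹ i j * ricci g i j x

/-- The Riemannian volume measure `dv_g = √(det g) dx`. -/
def riemannianVolume (g : MetricField n) : Measure (Euc n) :=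
  (volume : Measure (Euc n)).withDensity fun x => ENNReal.ofReal (Real.sqrt (g x).det)

/-- The length `|v|_g = √(∑_{i,j} g_ij(x) v_i v_j)` of tangent vectors `v` at `x`. -/
@[reducible]
def tangentENorm (g : MetricField n) (x : Euc n) :
    ENorm (TangentSpace 𝓘(ℝ, Euc n) x) where
  enorm := fun v : Euc n => ENNReal.ofReal (Real.sqrt (∑ i, ∑ j, g x i j * v i * v j))

/-- The Riemannian distance of `g`: the infimum of the `g`-lengths of `C¹` curves from `x` to `y`. -/
def riemannianDist (g : MetricField n) (x y : Euc n) : ℝ≥0∞ :=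
  @Manifold.riemannianEDist (Euc n) _ _ (Euc n) _ 𝓘(ℝ, Euc n) (Euc n) _ _ (tangentENorm g) x y

/-- `g` is complete: every Cauchy sequence for the Riemannian distance of `g` converges for it. -/
def IsComplete (g : MetricField n) : Prop :=
  ∀ u : ℕ → Euc n,
    (∀ ε : ℝ≥0∞, 0 < ε → ∃ N, ∀ p ≥ N, ∀ q ≥ N, riemannianDist g (u p) (u q) < ε) →
      ∃ x, Tendsto (fun k => riemannianDist g (u k) x) atTop (𝓝 0)

end MetricField

/-- The conformally flat metric `e^{2w} g₀`, with `g₀` the Euclidean metric. -/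
def conformalMetric {n : ℕ} (w : Euc n → ℝ) : MetricField n :=
  fun x => Real.exp (2 * w x) • (1 : Matrix (Fin n) (Fin n) ℝ)

/-- The (critical, `n`-th order) `Q`-curvature of `g = e^{2w} g₀` on `ℝⁿ`, `n = 2m`:
`Q_g = e^{-nw} (-Δ)^m w`, with `Δ = ∑_i ∂_i²` the flat Laplacian. -/
def qCurvature {m : ℕ} (w : Euc (2 * m) → ℝ) (x : Euc (2 * m)) : ℝ :=
  Real.exp (-((2 * m : ℕ) : ℝ) * w x) *
    ((fun f : Euc (2 * m) → ℝ => -(Laplacian.laplacian f))^[m] w x)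

/-- `C_n = 1 / (((n-2)‼)² |S^{n-1}|)` (used for even `n ≥ 2`), where `|S^{n-1}|` is the total
surface measure of the unit sphere of `ℝⁿ`. -/
def gaussBonnetConst (n : ℕ) : ℝ :=
  1 / (((n - 2).doubleFactorial : ℝ) ^ 2 *
    (volume : Measure (Euc n)).toSphere.real Set.univ)

end

/-! ### Lengths and distances of the metric `e^{2w} g₀`. -/

section ConformalDistance

variable {n : ℕ}

open MetricField

/-! Suppose that `α = C_n ∫ Q dv > 1`. The proof shows that `w` then decays so fast that the metric
cannot be complete.

Spherical means. Since `Q dv = (-Δ)^m w dx`, let `W_j(r)` be the integral of `(-Δ)^j w` over the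
sphere of radius `r`, parametrised by the unit sphere. The divergence theorem gives `W_j' = -r^{1-n}
∫_0^r s^{n-1} W_{j+1}`, and at the top the integral `∫_0^r s^{n-1} W_m` tends to `∫ Q dv`.
Integrating down the hierarchy could produce polynomial terms. The curvature condition excludes
them: it says `-Δw ≥ (m-1)|∇w|²` near infinity, so by Cauchy-Schwarz `W_1 ≥ κ (W_0')²` for some `κ >
0` when `m ≥ 2`, whereas growth `W_1 ~ C r^{2p}` would force `(W_0')² ~ c² r^{4p+2}` (`no_growth`).
Hence every `W_i` with `1 ≤ i < m` tends to zero at an exact rate (`decay_step`), and the mean of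
`w` is asymptotic to `-α log r` (`tendsto_mul_deriv_hierarchy`, `exists_sphInt_lt_log`).

Case `n ≥ 4`. The curvature condition makes `e^{(m-1)w}` superharmonic near infinity
(`laplacian_exp_mul`). The mean value inequality at a point `z` with `‖z‖ = r` and `w(z) ≤ -β log
r`, where `1 < β`, bounds the integral of `e^w` over a ball of radius `2r` by `C r^{n-β}`
(`exists_integral_exp_le`). Dyadic summation shows that `e^w |x|^{1-n}` is integrable near infinity,
that is, almost every ray has finite length. This contradicts the properness of a complete metric
(`exists_cdist_ge_of_isComplete`).

Case `n = 2`. Now `Δw ≤ 0` near infinity and the gradient term is absent. For `1 < γ < β`, the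
function `u = -w - γ log|x| - c` (with a regularised logarithm) is subharmonic near infinity, and
`u₊³ e^{2w}` is at most a multiple of `|x|^{-2γ}`, which is integrable. If the metric is complete,
cutoffs with small conformal gradient and Caccioppoli's inequality show that `u₊` vanishes
(`mul_max_zero_sq_eq_of_isComplete`), so `w ≥ -c - γ log|x|` up to a bounded term, against the decay
of the means. -/

theorem sqrt_conformalMetric (w : Euc n → ℝ) (x v : Euc n) :
    Real.sqrt (∑ i, ∑ j, conformalMetric w x i j * v i * v j) = Real.exp (w x) * ‖v‖ := by
  have h : (∑ i, ∑ j, conformalMetric w x i j * v i * v j) = (Real.exp (w x) * ‖v‖) ^ 2 := by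
    rw [mul_pow, EuclideanSpace.real_norm_sq_eq, ← Real.exp_nat_mul, Finset.mul_sum]
    refine Finset.sum_congr rfl fun i _ => ?_
    rw [Finset.sum_eq_single i]
    · simp [conformalMetric]; ring
    · intro j _ hj
      simp [conformalMetric, Matrix.one_apply_ne hj.symm]
    · simp
  rw [h, Real.sqrt_sq (by positivity)]

theorem tangentENorm_conformalMetric (w : Euc n → ℝ) (x v : Euc n) :
    (tangentENorm (conformalMetric w) x).enorm v = ENNReal.ofReal (Real.exp (w x)) * ‖v‖ₑ := by
  rw [← ofReal_norm, ← ENNReal.ofReal_mul (Real.exp_pos _).le, ← sqrt_conformalMetric]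
  rfl

/-- The general facts about `Manifold.riemannianEDist` require lengths of tangent vectors to be
homogeneous; this supplies the instance. -/
theorem conformal_enormSMulClass (w : Euc n → ℝ) (x : Euc n) :
    @ENormSMulClass ℝ (TangentSpace 𝓘(ℝ, Euc n) x) _ (tangentENorm (conformalMetric w) x) _ := by
  let _ := tangentENorm (conformalMetric w) x
  have key : ∀ (c : ℝ) (v : Euc n), (tangentENorm (conformalMetric w) x).enorm (c • v) =
      ‖c‖ₑ * (tangentENorm (conformalMetric w) x).enorm v := fun c v => by
    have h1 := tangentENorm_conformalMetric w x (c • v)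
    rw [enorm_smul, mul_left_comm, ← tangentENorm_conformalMetric w x v] at h1
    exact h1
  exact ⟨fun c v => key c v⟩

/-- The length of `γ` on `[a, b]` for the metric `e^{2w} g₀`. -/
noncomputable def conformalLength (w : Euc n → ℝ) (γ : ℝ → Euc n) (a b : ℝ) : ℝ≥0∞ :=
  ∫⁻ t in Set.Icc a b, ENNReal.ofReal (Real.exp (w (γ t))) * ‖deriv γ t‖ₑ

theorem pathELength_conformal (w : Euc n → ℝ) (γ : ℝ → Euc n) (a b : ℝ) :
    @Manifold.pathELength (Euc n) _ _ (Euc n) _ 𝓘(ℝ, Euc n) (Euc n) _ _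
      (tangentENorm (conformalMetric w)) γ a b = conformalLength w γ a b := by
  let _ := tangentENorm (conformalMetric w)
  rw [Manifold.pathELength_eq_lintegral_mfderiv_Icc, conformalLength]
  refine lintegral_congr fun t => ?_
  refine Eq.trans ?_ (tangentENorm_conformalMetric w (γ t) (deriv γ t))
  rw [mfderiv_eq_fderiv]
  rfl

/-- The Riemannian distance of `e^{2w} g₀`. -/
noncomputable abbrev cdist (w : Euc n → ℝ) (x y : Euc n) : ℝ≥0∞ :=
  (conformalMetric w).riemannianDist x y

theorem cdist_self (w : Euc n → ℝ) (x : Euc n) : cdist w x x = 0 := by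
  let _ := tangentENorm (conformalMetric w)
  have := conformal_enormSMulClass w
  exact Manifold.riemannianEDist_self

theorem cdist_comm (w : Euc n → ℝ) (x y : Euc n) : cdist w x y = cdist w y x := by
  let _ := tangentENorm (conformalMetric w)
  have := conformal_enormSMulClass w
  exact Manifold.riemannianEDist_comm

theorem cdist_triangle (w : Euc n → ℝ) (x y z : Euc n) :
    cdist w x z ≤ cdist w x y + cdist w y z := by
  let _ := tangentENorm (conformalMetric w)
  have := conformal_enormSMulClass w
  exact Manifold.riemannianEDist_triangle

theorem cdist_le_length (w : Euc n → ℝ) {γ : ℝ → Euc n} (hγ : ContDiff ℝ 1 γ) {a b : ℝ}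
    (hab : a ≤ b) : cdist w (γ a) (γ b) ≤ conformalLength w γ a b := by
  let _ := tangentENorm (conformalMetric w)
  have := conformal_enormSMulClass w
  rw [← pathELength_conformal]
  exact Manifold.riemannianEDist_le_pathELength (hγ.contMDiff.contMDiffOn) rfl rfl hab

theorem exists_curve_of_cdist_lt (w : Euc n → ℝ) {x y : Euc n} {r : ℝ≥0∞} (h : cdist w x y < r) :
    ∃ γ : ℝ → Euc n, γ 0 = x ∧ γ 1 = y ∧ ContDiff ℝ 1 γ ∧ conformalLength w γ 0 1 < r := by
  let _ := tangentENorm (conformalMetric w)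
  have := conformal_enormSMulClass w
  obtain ⟨γ, h0, h1, hs, hl, -⟩ :=
    Manifold.exists_lt_locally_constant_of_riemannianEDist_lt (I := 𝓘(ℝ, Euc n)) h zero_lt_one
  exact ⟨γ, h0, h1, contMDiff_iff_contDiff.1 hs, by rwa [← pathELength_conformal]⟩

theorem conformalLength_add (w : Euc n → ℝ) (γ : ℝ → Euc n) {a b c : ℝ} (h : a ≤ b) (h' : b ≤ c) :
    conformalLength w γ a b + conformalLength w γ b c = conformalLength w γ a c := by
  let _ := tangentENorm (conformalMetric w)
  simp only [← pathELength_conformal]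
  exact Manifold.pathELength_add h h'

/-- A curve from `x` to a point at Euclidean distance at least `ρ` crosses the sphere of
radius `ρ` about `x`. -/
theorem exists_crossing_time {γ : ℝ → Euc n} (hγ : Continuous γ) {ρ : ℝ} (hρ : 0 ≤ ρ)
    (h : ρ ≤ dist (γ 1) (γ 0)) :
    ∃ t ∈ Set.Icc (0 : ℝ) 1, dist (γ t) (γ 0) = ρ ∧ ∀ s ∈ Set.Icc 0 t, dist (γ s) (γ 0) ≤ ρ := by
  have hc : Continuous fun t => dist (γ t) (γ 0) := by fun_prop
  set S := Set.Icc (0 : ℝ) 1 ∩ {t | ρ ≤ dist (γ t) (γ 0)}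
  have hS : IsCompact S := isCompact_Icc.inter_right (isClosed_le continuous_const hc)
  have hne : S.Nonempty := ⟨1, by simp, h⟩
  obtain ⟨t, htS, htmin⟩ := hS.exists_isLeast hne
  have hlt : ∀ s ∈ Set.Ico 0 t, dist (γ s) (γ 0) < ρ := fun s hs => by
    by_contra hcon
    exact absurd (htmin ⟨⟨hs.1, hs.2.le.trans htS.1.2⟩, not_lt.1 hcon⟩) (not_le.2 hs.2)
  have hle : dist (γ t) (γ 0) ≤ ρ := by
    rcases htS.1.1.eq_or_lt with h0 | h0
    · rw [← h0]; simpa using hρ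
    · refine le_of_tendsto (hc.continuousWithinAt (s := Set.Iio t) (x := t)) ?_
      filter_upwards [Ioo_mem_nhdsLT h0] with s hs using (hlt s ⟨hs.1.le, hs.2⟩).le
  refine ⟨t, htS.1, le_antisymm hle htS.2, fun s hs => ?_⟩
  rcases hs.2.eq_or_lt with rfl | h1
  · exact hle
  · exact (hlt s ⟨hs.1, h1⟩).le

/-- A nearly minimising curve is cut at its crossing of the sphere. This replaces minimising
geodesics in the properness argument. -/
theorem cdist_cross (w : Euc n → ℝ) {x y : Euc n} {ρ : ℝ} (hρ : 0 ≤ ρ) (h : ρ ≤ dist y x)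
    {r : ℝ≥0∞} (hr : cdist w x y < r) :
    ∃ z, dist z x = ρ ∧ cdist w x z + cdist w z y < r := by
  obtain ⟨γ, rfl, rfl, hγ, hl⟩ := exists_curve_of_cdist_lt w hr
  obtain ⟨t, ht, htρ, -⟩ := exists_crossing_time hγ.continuous hρ h
  refine ⟨γ t, htρ, lt_of_le_of_lt ?_ hl⟩
  rw [← conformalLength_add w γ ht.1 ht.2]
  exact add_le_add (cdist_le_length w hγ ht.1) (cdist_le_length w hγ ht.2)

/-- Up to its first crossing of the sphere of radius `ρ`, a curve stays where `e^w ≥ c` and has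
Euclidean length at least `ρ`. -/
theorem le_cdist (w : Euc n → ℝ) {x y : Euc n} {ρ c : ℝ} (hρ : 0 ≤ ρ) (h : ρ ≤ dist y x)
    (hc0 : 0 ≤ c) (hc : ∀ z, dist z x ≤ ρ → c ≤ Real.exp (w z)) :
    ENNReal.ofReal (c * ρ) ≤ cdist w x y := by
  refine le_of_forall_gt fun r hr => ?_
  obtain ⟨γ, rfl, rfl, hγ, hl⟩ := exists_curve_of_cdist_lt w hr
  obtain ⟨t, ht, htρ, hts⟩ := exists_crossing_time hγ.continuous hρ h
  refine lt_of_le_of_lt ?_ hl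
  have hd : Continuous (deriv γ) := hγ.continuous_deriv le_rfl
  have h1 : ∫ s in (0 : ℝ)..t, deriv γ s = γ t - γ 0 :=
    intervalIntegral.integral_deriv_eq_sub (fun s _ => hγ.differentiable one_ne_zero s)
      (hd.intervalIntegrable _ _)
  calc ENNReal.ofReal (c * ρ) = ENNReal.ofReal c * ‖γ t - γ 0‖ₑ := by
        rw [ENNReal.ofReal_mul hc0, ← ofReal_norm, ← dist_eq_norm, htρ]
    _ ≤ ENNReal.ofReal c * ∫⁻ s in Set.Icc 0 t, ‖deriv γ s‖ₑ := by
        gcongr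
        rw [← h1, intervalIntegral.integral_of_le ht.1, integral_Icc_eq_integral_Ioc.symm]
        exact enorm_integral_le_lintegral_enorm _
    _ = ∫⁻ s in Set.Icc 0 t, ENNReal.ofReal c * ‖deriv γ s‖ₑ := by
        rw [lintegral_const_mul _ hd.enorm.measurable]
    _ ≤ conformalLength w γ 0 t := by
        refine setLIntegral_mono' measurableSet_Icc fun s hs => ?_
        gcongr
        exact hc _ (hts s hs)
    _ ≤ conformalLength w γ 0 1 := by
        rw [← conformalLength_add w γ ht.1 ht.2]; exact le_self_add

theorem cdist_le_segment (w : Euc n → ℝ) (x y : Euc n) {C : ℝ}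
    (hC : ∀ z ∈ segment ℝ x y, Real.exp (w z) ≤ C) :
    cdist w x y ≤ ENNReal.ofReal (C * dist x y) := by
  have hC0 : 0 ≤ C := (Real.exp_pos _).le.trans (hC x (left_mem_segment ℝ x y))
  set γ : ℝ → Euc n := fun t => x + t • (y - x)
  have hγ : ContDiff ℝ 1 γ := by fun_prop
  have hd : ∀ t, deriv γ t = y - x := fun t => by
    have : HasDerivAt γ (y - x) t := by
      simpa [γ] using ((hasDerivAt_id t).smul_const (y - x)).const_add x
    exact this.deriv
  have h := cdist_le_length w hγ zero_le_one
  simp only [γ, zero_smul, add_zero, one_smul, add_sub_cancel] at h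
  refine h.trans ?_
  calc conformalLength w γ 0 1
      ≤ ∫⁻ t in Set.Icc (0 : ℝ) 1, ENNReal.ofReal (C * dist x y) := by
        refine setLIntegral_mono' measurableSet_Icc fun s hs => ?_
        rw [hd, ENNReal.ofReal_mul hC0, dist_comm x y, dist_eq_norm, ofReal_norm]
        gcongr
        refine hC _ ?_
        rw [segment_eq_image']
        exact ⟨s, hs, rfl⟩
    _ = ENNReal.ofReal (C * dist x y) := by simp

theorem cdist_le_ray (w : Euc n → ℝ) {σ : Euc n} (hσ : ‖σ‖ = 1) {a b : ℝ} (hab : a ≤ b) :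
    cdist w (a • σ) (b • σ) ≤ ∫⁻ t in Set.Icc a b, ENNReal.ofReal (Real.exp (w (t • σ))) := by
  set γ : ℝ → Euc n := fun t => t • σ
  have hγ : ContDiff ℝ 1 γ := by fun_prop
  have hd : ∀ t, deriv γ t = σ := fun t => by
    have : HasDerivAt γ σ t := by
      simpa [γ] using ((hasDerivAt_id t).smul_const σ)
    exact this.deriv
  refine (cdist_le_length w hγ hab).trans (le_of_eq ?_)
  simp only [conformalLength, hd, γ]
  have : ‖σ‖ₑ = 1 := by rw [← ofReal_norm, hσ]; simp
  simp [this]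

end ConformalDistance

/-! ### Completeness implies properness (Hopf-Rinow for `e^{2w} g₀`). -/

section Properness

variable {n : ℕ}

/-- Near `z`, the conformal distance is bounded by a multiple of the Euclidean one. -/
theorem exists_cdist_le_on_closedBall {w : Euc n → ℝ} (hw : Continuous w) (z : Euc n) (R : ℝ) :
    ∃ C : ℝ, 0 < C ∧ ∀ x ∈ Metric.closedBall z R, ∀ y ∈ Metric.closedBall z R,
      cdist w x y ≤ ENNReal.ofReal (C * dist x y) := by
  obtain ⟨M, hM⟩ := (isCompact_closedBall z R).bddAbove_image (f := fun x => Real.exp (w x))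
    (by fun_prop)
  refine ⟨max M 1, by positivity, fun x hx y hy => cdist_le_segment w x y fun u hu => ?_⟩
  exact (hM ⟨u, (convex_closedBall z R).segment_subset hx hy hu, rfl⟩).trans (le_max_left _ _)

theorem cdist_ne_top {w : Euc n → ℝ} (hw : Continuous w) (x y : Euc n) : cdist w x y ≠ ⊤ := by
  obtain ⟨C, -, h⟩ := exists_cdist_le_on_closedBall hw x (dist y x)
  exact ne_top_of_le_ne_top ENNReal.ofReal_ne_top (h x (by simp) y (by simp))

theorem tendsto_cdist_of_tendsto {w : Euc n → ℝ} (hw : Continuous w) {u : ℕ → Euc n} {z : Euc n}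
    (h : Tendsto u atTop (𝓝 z)) : Tendsto (fun k => cdist w z (u k)) atTop (𝓝 0) := by
  obtain ⟨C, hC, hb⟩ := exists_cdist_le_on_closedBall hw z 1
  have h1 : Tendsto (fun k => ENNReal.ofReal (C * dist z (u k))) atTop (𝓝 0) := by
    have : Tendsto (fun k => C * dist z (u k)) atTop (𝓝 (C * dist z z)) :=
      (tendsto_const_nhds.dist h).const_mul C
    simpa [Function.comp_def] using (ENNReal.continuous_ofReal.tendsto _).comp this
  refine tendsto_of_tendsto_of_tendsto_of_le_of_le' tendsto_const_nhds h1 (by simp) ?_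
  filter_upwards [h.eventually (Metric.closedBall_mem_nhds z one_pos)] with k hk
  exact hb z (by simp) _ hk

/-- Leaving the Euclidean ball of radius `min ε 1` about `z` costs conformal length at least that
radius times the minimum of `e^w` on the closed unit ball about `z`. -/
theorem tendsto_of_tendsto_cdist {w : Euc n → ℝ} (hw : Continuous w) {u : ℕ → Euc n} {z : Euc n}
    (h : Tendsto (fun k => cdist w (u k) z) atTop (𝓝 0)) : Tendsto u atTop (𝓝 z) := by
  obtain ⟨x₀, -, hx₀⟩ := (isCompact_closedBall z 1).exists_isMinOn
    (Metric.nonempty_closedBall.2 zero_le_one) (f := fun x => Real.exp (w x)) (by fun_prop)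
  refine Metric.tendsto_atTop'.2 fun ε hε => ?_
  have hpos : 0 < ENNReal.ofReal (Real.exp (w x₀) * min ε 1) := by
    have := Real.exp_pos (w x₀)
    rw [ENNReal.ofReal_pos]; positivity
  obtain ⟨N, hN⟩ := (h.eventually (gt_mem_nhds hpos)).exists_forall_of_atTop
  refine ⟨N, fun k hk => ?_⟩
  by_contra hcon
  have hk' := hN k hk.le
  rw [cdist_comm] at hk'
  refine absurd hk' (not_lt.2 (le_cdist w (by positivity) ((min_le_left _ _).trans (not_lt.1 hcon))
    (Real.exp_pos _).le fun x hx => hx₀ ?_))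
  exact hx.trans (min_le_right _ _)

/-- Points of arbitrarily large norm lie at conformal distance less than `r` from `x`. -/
def ReachesInfinity (w : Euc n → ℝ) (x : Euc n) (r : ℝ≥0∞) : Prop :=
  ∀ R : ℝ, ∃ y, R ≤ ‖y‖ ∧ cdist w x y < r

/-- Short curves from `x` to the far points `y k` cross the unit sphere about `x`. A limit point of
the crossings still reaches infinity, with what remains of the budget `r + ε`. -/
theorem ReachesInfinity.step {w : Euc n → ℝ} (hw : Continuous w) {x : Euc n} {r : ℝ≥0∞}
    (h : ReachesInfinity w x r) {ε : ℝ≥0∞} (hε : 0 < ε) (hε' : ε ≠ ⊤) :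
    ∃ z s, dist z x = 1 ∧ ReachesInfinity w z s ∧ s + cdist w x z ≤ r + ε := by
  choose y hy hyr using fun k : ℕ => h (k + ‖x‖ + 1)
  have hd : ∀ k, 1 ≤ dist (y k) x := fun k => by
    have h1 := hy k
    have h2 := norm_sub_norm_le (y k) x
    have h3 : (0 : ℝ) ≤ k := k.cast_nonneg
    rw [dist_eq_norm]; linarith
  choose z hz hzr using fun k => cdist_cross w zero_le_one (hd k) (hyr k)
  obtain ⟨z₀, hz₀, φ, hφ, hlim⟩ := (isCompact_sphere x 1).tendsto_subseq (x := z) (fun k => hz k)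
  have hδ : 0 < ε / 2 := ENNReal.half_pos hε.ne'
  have hev := (tendsto_cdist_of_tendsto hw hlim).eventually (gt_mem_nhds hδ)
  have key : ∀ᶠ k in atTop, cdist w x z₀ + cdist w z₀ (y (φ k)) < r + ε := by
    filter_upwards [hev] with k hk
    have h1 := cdist_triangle w x (z (φ k)) z₀
    have h2 := cdist_triangle w z₀ (z (φ k)) (y (φ k))
    rw [cdist_comm w (z (φ k)) z₀] at h1
    calc cdist w x z₀ + cdist w z₀ (y (φ k))
        ≤ (cdist w x (z (φ k)) + ε / 2) + (ε / 2 + cdist w (z (φ k)) (y (φ k))) :=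
          add_le_add (h1.trans (by gcongr; exact hk.le)) (h2.trans (by gcongr; exact hk.le))
      _ = (cdist w x (z (φ k)) + cdist w (z (φ k)) (y (φ k))) + (ε / 2 + ε / 2) := by ring
      _ = (cdist w x (z (φ k)) + cdist w (z (φ k)) (y (φ k))) + ε := by rw [ENNReal.add_halves]
      _ < r + ε := ENNReal.add_lt_add_right hε' (hzr _)
  have hle : cdist w x z₀ ≤ r + ε := by
    obtain ⟨k, hk⟩ := key.exists
    exact le_self_add.trans hk.le
  refine ⟨z₀, r + ε - cdist w x z₀, hz₀, fun R => ?_, (tsub_add_cancel_of_le hle).le⟩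
  obtain ⟨k, hk, hkR⟩ := (key.and (eventually_ge_atTop ⌈R⌉₊)).exists
  refine ⟨y (φ k), ?_, ?_⟩
  · have h1 := hy (φ k)
    have h2 : (k : ℝ) ≤ φ k := by exact_mod_cast hφ.id_le k
    have h3 : R ≤ k := (Nat.le_ceil R).trans (by exact_mod_cast hkR)
    have := norm_nonneg x
    linarith
  · rw [lt_tsub_iff_right, add_comm]
    exact hk

/-- For a complete conformal metric, distances to the origin tend to infinity. -/
theorem exists_cdist_ge_of_isComplete {w : Euc n → ℝ} (hw : Continuous w)
    (hc : (conformalMetric w).IsComplete) (D : ℝ≥0∞) (hD : D ≠ ⊤) :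
    ∃ R : ℝ, ∀ y, R ≤ ‖y‖ → D ≤ cdist w 0 y := by
  by_contra hcon
  push Not at hcon
  have h0 : ReachesInfinity w 0 D := hcon
  have hε : ∀ k : ℕ, (0 : ℝ≥0∞) < 2⁻¹ ^ k := fun k => by
    apply pos_iff_ne_zero.2; simp
  choose! f g hfx hfr hfs using fun (k : ℕ) (x : Euc n) (r : ℝ≥0∞) (h : ReachesInfinity w x r) =>
    h.step hw (hε k) (by simp)
  -- Iterating the step with errors `2⁻ᵏ` produces points with consecutive Euclidean distance `1`
  -- and finite total conformal length. They form a Cauchy sequence, and its limit is incompatible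
  -- with the unit steps.
  let S : ℕ → Euc n × ℝ≥0∞ := fun k => Nat.rec (0, D) (fun j p => (f j p.1 p.2, g j p.1 p.2)) k
  have hR : ∀ k, ReachesInfinity w (S k).1 (S k).2 := by
    intro k
    induction k with
    | zero => exact h0
    | succ k ih => exact hfr k _ _ ih
  have hdist : ∀ k, dist (S (k + 1)).1 (S k).1 = 1 := fun k => hfx k _ _ (hR k)
  have hsum : ∀ k, (S (k + 1)).2 + cdist w (S k).1 (S (k + 1)).1 ≤ (S k).2 + 2⁻¹ ^ k :=
    fun k => hfs k _ _ (hR k)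
  have hfin : ∀ k, (S k).2 ≠ ⊤ := by
    intro k
    induction k with
    | zero => exact hD
    | succ k ih =>
      refine ne_top_of_le_ne_top ?_ (le_self_add.trans (hsum k))
      exact ENNReal.add_ne_top.2 ⟨ih, by simp⟩
  -- The term `2 · 2⁻ᵏ` is the sum of all errors still to come, so `a` is antitone and its
  -- decrements bound the distances between successive points.
  set a : ℕ → ℝ := fun k => (S k).2.toReal + 2 * (1 / 2) ^ k
  have ha : ∀ k, (cdist w (S k).1 (S (k + 1)).1).toReal ≤ a k - a (k + 1) := by
    intro k
    have h := (ENNReal.toReal_le_toReal (by simp [hfin, cdist_ne_top hw])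
      (by simp [hfin])).2 (hsum k)
    rw [ENNReal.toReal_add (hfin (k + 1)) (cdist_ne_top hw (S k).1 (S (k + 1)).1),
      ENNReal.toReal_add (hfin k) (by simp)] at h
    have h2 : ((2⁻¹ : ℝ≥0∞) ^ k).toReal = (1 / 2) ^ k := by simp
    rw [h2] at h
    simp only [a, pow_succ]
    linarith
  have hanti : Antitone a := antitone_nat_of_succ_le fun k => by
    have := ha k
    have h2 : 0 ≤ (cdist w (S k).1 (S (k + 1)).1).toReal := ENNReal.toReal_nonneg
    linarith
  have hbdd : BddBelow (Set.range a) := ⟨0, by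
    rintro _ ⟨k, rfl⟩
    have : 0 ≤ (S k).2.toReal := ENNReal.toReal_nonneg
    simp only [a]; positivity⟩
  have hlim := tendsto_atTop_ciInf hanti hbdd
  have hpq : ∀ p q, p ≤ q → cdist w (S p).1 (S q).1 ≤ ENNReal.ofReal (a p - a q) := by
    intro p q hpq
    induction q, hpq using Nat.le_induction with
    | base => simp [cdist_self]
    | succ q hq ih =>
      have h1 := ha q
      have h2 : cdist w (S q).1 (S (q + 1)).1 ≤ ENNReal.ofReal (a q - a (q + 1)) :=
        (ENNReal.le_ofReal_iff_toReal_le (cdist_ne_top hw _ _)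
          (sub_nonneg.2 (hanti q.le_succ))).2 h1
      refine (cdist_triangle w _ (S q).1 _).trans ((add_le_add ih h2).trans ?_)
      rw [← ENNReal.ofReal_add (sub_nonneg.2 (hanti hq)) (sub_nonneg.2 (hanti q.le_succ))]
      simp
  have hsmall : ∀ ε : ℝ≥0∞, 0 < ε → ∃ N, ∀ p ≥ N, ENNReal.ofReal (a p - ⨅ i, a i) < ε := by
    intro ε hε
    have : Tendsto (fun p => ENNReal.ofReal (a p - ⨅ i, a i)) atTop (𝓝 0) := by
      have h1 := (ENNReal.continuous_ofReal.tendsto _).comp (hlim.sub_const (⨅ i, a i))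
      simpa [Function.comp_def] using h1
    exact (this.eventually (gt_mem_nhds hε)).exists_forall_of_atTop
  have hbound : ∀ p q, p ≤ q → cdist w (S p).1 (S q).1 ≤ ENNReal.ofReal (a p - ⨅ i, a i) :=
    fun p q h => (hpq p q h).trans (ENNReal.ofReal_le_ofReal
      (sub_le_sub_left (ciInf_le hbdd q) _))
  obtain ⟨x, hx⟩ := hc (fun k => (S k).1) fun ε hε => by
    obtain ⟨N, hN⟩ := hsmall ε hε
    refine ⟨N, fun p hp q hq => ?_⟩
    rcases le_total p q with h | h
    · exact (hbound p q h).trans_lt (hN p hp)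
    · change cdist w _ _ < ε
      rw [cdist_comm]
      exact (hbound q p h).trans_lt (hN q hq)
  have hx' := tendsto_of_tendsto_cdist hw hx
  have h1 : Tendsto (fun k => dist (S (k + 1)).1 (S k).1) atTop (𝓝 (dist x x)) :=
    ((tendsto_add_atTop_iff_nat 1).2 hx').dist hx'
  simp only [hdist, dist_self] at h1
  exact one_ne_zero (tendsto_nhds_unique tendsto_const_nhds h1)

end Properness

/-! ### Polar coordinates and integrals over spheres. -/

section Polar

variable {n : ℕ}

/-- The surface measure of the unit sphere. -/
noncomputable abbrev sphereMeasure (n : ℕ) : Measure (Metric.sphere (0 : Euc n) 1) :=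
  (volume : Measure (Euc n)).toSphere

/-- The integral of `f(r •)` over the unit sphere. -/
noncomputable def sphInt (f : Euc n → ℝ) (r : ℝ) : ℝ :=
  ∫ σ, f (r • (σ : Euc n)) ∂sphereMeasure n

theorem volumeIoiPow_eq (k : ℕ) : Measure.volumeIoiPow k =
    (Measure.comap Subtype.val volume : Measure (Set.Ioi (0 : ℝ))).withDensity
      fun r => ENNReal.ofReal (r.1 ^ k) := rfl

theorem lintegral_polar (hn : n ≠ 0) {g : Euc n → ℝ≥0∞} (hg : Measurable g) :
    ∫⁻ x, g x = ∫⁻ σ : Metric.sphere (0 : Euc n) 1, (∫⁻ r in Set.Ioi (0 : ℝ),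
      ENNReal.ofReal (r ^ (n - 1)) * g (r • (σ : Euc n))) ∂sphereMeasure n := by
  have : NeZero n := ⟨hn⟩
  have hmp := (volume : Measure (Euc n)).measurePreserving_homeomorphUnitSphereProd
  rw [finrank_euclideanSpace_fin] at hmp
  have h1 : ∫⁻ x, g x = ∫⁻ x : ({0}ᶜ : Set (Euc n)), g x ∂(Measure.comap Subtype.val volume) := by
    rw [lintegral_subtype_comap (measurableSet_singleton (0 : Euc n)).compl g,
      restrict_compl_singleton]
  have h2 : Measurable fun p : Metric.sphere (0 : Euc n) 1 × Set.Ioi (0 : ℝ) =>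
      g ((p.2 : ℝ) • (p.1 : Euc n)) := hg.comp (by fun_prop)
  have h3 := hmp.lintegral_comp h2
  have h4 : ∀ x : ({0}ᶜ : Set (Euc n)),
      ((homeomorphUnitSphereProd (Euc n) x).2 : ℝ) •
        ((homeomorphUnitSphereProd (Euc n) x).1 : Euc n) = x := fun x => by
    have hx : ‖(x : Euc n)‖ ≠ 0 := norm_ne_zero_iff.2 x.2
    simp [smul_smul, hx]
  simp only [h4] at h3
  rw [h1, h3, lintegral_prod _ h2.aemeasurable]
  refine lintegral_congr fun σ => ?_
  have h5 : Measurable fun r : Set.Ioi (0 : ℝ) => g ((r : ℝ) • (σ : Euc n)) :=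
    hg.comp (by fun_prop)
  rw [volumeIoiPow_eq, lintegral_withDensity_eq_lintegral_mul _ (by fun_prop) h5]
  simp only [Pi.mul_apply]
  rw [lintegral_subtype_comap measurableSet_Ioi
    (fun r : ℝ => ENNReal.ofReal (r ^ (n - 1)) * g (r • (σ : Euc n)))]

theorem polar_integrable_prod (hn : n ≠ 0) {g : Euc n → ℝ} (hg : Integrable g) :
    Integrable (fun p : Metric.sphere (0 : Euc n) 1 × Set.Ioi (0 : ℝ) =>
      g ((p.2 : ℝ) • (p.1 : Euc n))) ((sphereMeasure n).prod (.volumeIoiPow (n - 1))) ∧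
    ∫ x, g x = ∫ p : Metric.sphere (0 : Euc n) 1 × Set.Ioi (0 : ℝ),
      g ((p.2 : ℝ) • (p.1 : Euc n)) ∂((sphereMeasure n).prod (.volumeIoiPow (n - 1))) := by
  have : NeZero n := ⟨hn⟩
  have hmp := (volume : Measure (Euc n)).measurePreserving_homeomorphUnitSphereProd
  rw [finrank_euclideanSpace_fin] at hmp
  have h4 : ∀ x : ({0}ᶜ : Set (Euc n)),
      ((homeomorphUnitSphereProd (Euc n) x).2 : ℝ) •
        ((homeomorphUnitSphereProd (Euc n) x).1 : Euc n) = x := fun x => by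
    have hx : ‖(x : Euc n)‖ ≠ 0 := norm_ne_zero_iff.2 x.2
    simp [smul_smul, hx]
  constructor
  · rw [← hmp.integrable_comp_emb (Homeomorph.measurableEmbedding _)]
    simp only [Function.comp_def, h4]
    have := (integrableOn_iff_comap_subtypeVal
      (measurableSet_singleton (0 : Euc n)).compl (f := g) (μ := volume)).1 hg.integrableOn
    exact this
  · have h3 := hmp.integral_comp (Homeomorph.measurableEmbedding _)
      (fun p : Metric.sphere (0 : Euc n) 1 × Set.Ioi (0 : ℝ) => g ((p.2 : ℝ) • (p.1 : Euc n)))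
    simp only [h4] at h3
    rw [← h3, integral_subtype_comap (measurableSet_singleton (0 : Euc n)).compl g,
      restrict_compl_singleton]

theorem integral_polar (hn : n ≠ 0) {g : Euc n → ℝ} (hg : Integrable g) :
    IntegrableOn (fun r => r ^ (n - 1) * sphInt g r) (Set.Ioi 0) ∧
    ∫ x, g x = ∫ r in Set.Ioi (0 : ℝ), r ^ (n - 1) * sphInt g r := by
  obtain ⟨h1, h2⟩ := polar_integrable_prod hn hg
  have h3 := h1.integral_prod_right
  have h0 : Measurable fun r : Set.Ioi (0 : ℝ) => Real.toNNReal (r.1 ^ (n - 1)) := by fun_prop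
  have hrw : ∀ r : Set.Ioi (0 : ℝ), Real.toNNReal (r.1 ^ (n - 1)) •
      sphInt g r = (fun r : ℝ => r ^ (n - 1) * sphInt g r) r := fun r => by
    rw [NNReal.smul_def, Real.coe_toNNReal _ (pow_nonneg r.2.out.le _), smul_eq_mul]
  constructor
  · rw [volumeIoiPow_eq] at h3
    have h4 := (integrable_withDensity_iff_integrable_smul h0).1 h3
    rw [integrableOn_iff_comap_subtypeVal measurableSet_Ioi]
    refine h4.congr (Eventually.of_forall fun r => ?_)
    exact hrw r
  · rw [h2, integral_prod_symm _ h1, volumeIoiPow_eq]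
    simp only [ENNReal.ofReal]
    rw [integral_withDensity_eq_integral_smul h0,
      ← integral_subtype_comap measurableSet_Ioi (fun r : ℝ => r ^ (n - 1) * sphInt g r)]
    exact integral_congr_ae (Eventually.of_forall fun r => hrw r)

theorem continuous_sphInt {f : Euc n → ℝ} (hf : Continuous f) : Continuous (sphInt f) := by
  have := continuous_parametric_integral_of_continuous (μ := sphereMeasure n)
    (f := fun (r : ℝ) (σ : Metric.sphere (0 : Euc n) 1) => f (r • (σ : Euc n)))
    (by unfold Function.uncurry; fun_prop) (isCompact_univ)
  rw [Measure.restrict_univ] at this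
  exact this

theorem integrable_sphere {f : Metric.sphere (0 : Euc n) 1 → ℝ} (hf : Continuous f) :
    Integrable f (sphereMeasure n) :=
  hf.integrable_of_hasCompactSupport (HasCompactSupport.of_compactSpace f)

theorem hasDerivAt_sphInt {f : Euc n → ℝ} (hf : ContDiff ℝ 1 f) (r : ℝ) :
    HasDerivAt (sphInt f) (∫ σ, fderiv ℝ f (r • (σ : Euc n)) (σ : Euc n) ∂sphereMeasure n) r := by
  have hfd : Continuous (fderiv ℝ f) := hf.continuous_fderiv one_ne_zero
  obtain ⟨M, hM⟩ := (isCompact_closedBall (0 : Euc n) (|r| + 1)).bddAbove_image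
    (f := fun x => ‖fderiv ℝ f x‖) (by fun_prop)
  refine (hasDerivAt_integral_of_dominated_loc_of_deriv_le (bound := fun _ => M)
    (F := fun (r : ℝ) (σ : Metric.sphere (0 : Euc n) 1) => f (r • (σ : Euc n)))
    (F' := fun (r : ℝ) (σ : Metric.sphere (0 : Euc n) 1) => fderiv ℝ f (r • (σ : Euc n)) σ)
    (Metric.ball_mem_nhds r one_pos) ?_ ?_ ?_ ?_ ?_ ?_).2
  · refine Eventually.of_forall fun s => Continuous.aestronglyMeasurable ?_
    have := hf.continuous
    fun_prop
  · have := hf.continuous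
    exact integrable_sphere (by fun_prop)
  · exact Continuous.aestronglyMeasurable (by fun_prop)
  · refine Eventually.of_forall fun σ s hs => ?_
    have hσ : ‖(σ : Euc n)‖ = 1 := norm_eq_of_mem_sphere σ
    refine ((fderiv ℝ f _).le_opNorm _).trans ?_
    rw [hσ, mul_one]
    refine hM ⟨_, ?_, rfl⟩
    rw [mem_closedBall_zero_iff, norm_smul, hσ, mul_one, Real.norm_eq_abs]
    rw [Metric.mem_ball, Real.dist_eq] at hs
    have := abs_sub_abs_le_abs_sub s r
    linarith
  · exact integrable_const M
  · refine Eventually.of_forall fun σ s _ => ?_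
    have h1 := (hf.differentiable one_ne_zero (s • (σ : Euc n))).hasFDerivAt
    have h2 : HasDerivAt (fun s : ℝ => s • (σ : Euc n)) (σ : Euc n) s := by
      simpa using (hasDerivAt_id s).smul_const (σ : Euc n)
    exact h1.comp_hasDerivAt s h2

end Polar

/-! ### Green's identity and the derivative of spherical means. -/

section SphericalMeans

variable {n : ℕ}

open MetricField

theorem contDiff_pd {f : Euc n → ℝ} {k l : ℕ∞ω} (hf : ContDiff ℝ l f) (h : k + 1 ≤ l) (i : Fin n) :
    ContDiff ℝ k (pd i f) :=
  (hf.fderiv_right h).clm_apply contDiff_const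

theorem laplacian_eq_sum_pd {f : Euc n → ℝ} (hf : ContDiff ℝ 2 f) (x : Euc n) :
    Laplacian.laplacian f x = ∑ i, pd i (pd i f) x := by
  rw [congrFun (InnerProductSpace.laplacian_eq_iteratedFDeriv_orthonormalBasis f
    (EuclideanSpace.basisFun (Fin n) ℝ)) x]
  refine Finset.sum_congr rfl fun i _ => ?_
  have hd : DifferentiableAt ℝ (fderiv ℝ f) x :=
    (hf.fderiv_right (m := 1) (by norm_num)).differentiable one_ne_zero x
  rw [iteratedFDeriv_two_apply]
  unfold pd
  rw [fderiv_clm_apply hd (differentiableAt_const _)]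
  simp

theorem contDiff_laplacian {f : Euc n → ℝ} (hf : ContDiff ℝ ∞ f) :
    ContDiff ℝ ∞ (Laplacian.laplacian f) := by
  have : Laplacian.laplacian f = fun x => ∑ i, pd i (pd i f) x :=
    funext fun x => laplacian_eq_sum_pd (contDiff_infty.1 hf 2) x
  rw [this]
  exact ContDiff.sum fun i _ => contDiff_pd (l := ∞) (contDiff_pd (l := ∞) hf le_rfl i) le_rfl i

theorem continuous_laplacian {f : Euc n → ℝ} (hf : ContDiff ℝ 2 f) :
    Continuous (Laplacian.laplacian f) := by
  have : Laplacian.laplacian f = fun x => ∑ i, pd i (pd i f) x :=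
    funext fun x => laplacian_eq_sum_pd hf x
  rw [this]
  exact continuous_finsetSum _ fun i _ =>
    (contDiff_pd (k := 0) (contDiff_pd (k := 1) hf (by norm_num) i) (by norm_num) i).continuous

/-- Green's identity for a compactly supported `C¹` function `φ`. -/
theorem integral_mul_laplacian {f φ : Euc n → ℝ} (hf : ContDiff ℝ 2 f) (hφ : ContDiff ℝ 1 φ)
    (hc : HasCompactSupport φ) :
    ∫ x, φ x * Laplacian.laplacian f x = -∫ x, ∑ i, pd i φ x * pd i f x := by
  have h1 : ∀ i, ContDiff ℝ 1 (pd i f) := fun i => contDiff_pd hf (by norm_num) i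
  have hcf : ∀ i, Continuous (pd i f) := fun i => (h1 i).continuous
  have hcff : ∀ i, Continuous (pd i (pd i f)) := fun i =>
    (contDiff_pd (k := 0) (h1 i) (by norm_num) i).continuous
  have hcp : ∀ i, Continuous (pd i φ) := fun i =>
    (contDiff_pd (k := 0) hφ (by norm_num) i).continuous
  have hcpc : ∀ i, HasCompactSupport (pd i φ) := fun i =>
    (hc.fderiv_apply (𝕜 := ℝ) (EuclideanSpace.single i 1))
  have hI1 : ∀ i, Integrable fun x => φ x * pd i (pd i f) x := fun i =>
    (hφ.continuous.mul (hcff i)).integrable_of_hasCompactSupport hc.mul_right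
  have hI2 : ∀ i, Integrable fun x => pd i φ x * pd i f x := fun i =>
    ((hcp i).mul (hcf i)).integrable_of_hasCompactSupport (hcpc i).mul_right
  have hI3 : ∀ i, Integrable fun x => φ x * pd i f x := fun i =>
    (hφ.continuous.mul (hcf i)).integrable_of_hasCompactSupport hc.mul_right
  simp only [laplacian_eq_sum_pd hf, Finset.mul_sum]
  rw [integral_finsetSum _ fun i _ => hI1 i, integral_finsetSum _ fun i _ => hI2 i,
    ← Finset.sum_neg_distrib]
  refine Finset.sum_congr rfl fun i _ => ?_
  exact integral_mul_fderiv_eq_neg_fderiv_mul_of_integrable (hI2 i) (hI1 i) (hI3 i)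
    (fun x _ => hφ.differentiable one_ne_zero x) (fun x _ => (h1 i).differentiable one_ne_zero x)

theorem sum_mul_pd (f : Euc n → ℝ) (x v : Euc n) : ∑ i, v i * pd i f x = fderiv ℝ f x v := by
  conv_rhs => rw [← (EuclideanSpace.basisFun (Fin n) ℝ).sum_repr v]
  simp [pd]

theorem pd_comp_norm_sq {G : ℝ → ℝ} {G' : ℝ → ℝ} (hG : ∀ t, HasDerivAt G (G' t) t) (i : Fin n)
    (x : Euc n) : pd i (fun x => G (‖x‖ ^ 2)) x = 2 * G' (‖x‖ ^ 2) * x i := by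
  have h1 : HasFDerivAt (fun x : Euc n => ‖x‖ ^ 2) (2 • innerSL ℝ x) x :=
    (hasStrictFDerivAt_norm_sq x).hasFDerivAt
  have h2 := (hG (‖x‖ ^ 2)).comp_hasFDerivAt x h1
  unfold pd
  have h3 : (fun x : Euc n => G (‖x‖ ^ 2)) = G ∘ fun x => ‖x‖ ^ 2 := rfl
  rw [h3, h2.fderiv]
  simp [EuclideanSpace.inner_single_right]
  ring

/-- The radial derivative of `f` integrated over the unit sphere. -/
noncomputable def sphFlux (f : Euc n → ℝ) (r : ℝ) : ℝ :=
  ∫ σ, fderiv ℝ f (r • (σ : Euc n)) (σ : Euc n) ∂sphereMeasure n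

theorem continuous_sphFlux {f : Euc n → ℝ} (hf : ContDiff ℝ 1 f) : Continuous (sphFlux f) := by
  have hfd : Continuous (fderiv ℝ f) := hf.continuous_fderiv one_ne_zero
  have := continuous_parametric_integral_of_continuous (μ := sphereMeasure n)
    (f := fun (r : ℝ) (σ : Metric.sphere (0 : Euc n) 1) =>
      fderiv ℝ f (r • (σ : Euc n)) (σ : Euc n))
    (by unfold Function.uncurry; fun_prop) (isCompact_univ)
  rw [Measure.restrict_univ] at this
  exact this

theorem integral_Ioi_eq_of_eq_zero {h : ℝ → ℝ} {b : ℝ} (hb : 0 ≤ b) (h0 : ∀ r, b ≤ r → h r = 0) :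
    ∫ r in Set.Ioi 0, h r = ∫ r in (0 : ℝ)..b, h r := by
  rw [intervalIntegral.integral_of_le hb]
  refine setIntegral_eq_of_subset_of_forall_sdiff_eq_zero measurableSet_Ioi
    Set.Ioc_subset_Ioi_self fun x hx => h0 x ?_
  by_contra hcon
  exact hx.2 ⟨hx.1, (not_le.1 hcon).le⟩

/-- Green's identity tested against `G(‖x‖²)`, written in polar coordinates and integrated by parts
in `r`. Using `‖x‖²` keeps the test function `C¹` at the origin. -/
theorem sphFlux_weak (hn : n ≠ 0) {f : Euc n → ℝ} (hf : ContDiff ℝ 2 f) {G G' : ℝ → ℝ}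
    (hG : ∀ t, HasDerivAt G (G' t) t) (hG' : Continuous G') {b : ℝ} (hb : 0 ≤ b)
    (hsupp : ∀ t, b ^ 2 ≤ t → G t = 0) (hsupp' : ∀ t, b ^ 2 ≤ t → G' t = 0) :
    ∫ r in (0 : ℝ)..b, 2 * r * G' (r ^ 2) * (r ^ (n - 1) * sphFlux f r -
      ∫ s in (0 : ℝ)..r, s ^ (n - 1) * sphInt (Laplacian.laplacian f) s) = 0 := by
  set Y : ℝ → ℝ := fun r => ∫ s in (0 : ℝ)..r, s ^ (n - 1) * sphInt (Laplacian.laplacian f) s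
  have hlap := continuous_laplacian hf
  have hSl := continuous_sphInt hlap
  have hflux := continuous_sphFlux (hf.of_le (by norm_num : (1 : ℕ∞ω) ≤ 2))
  have hY : ∀ r, HasDerivAt Y (r ^ (n - 1) * sphInt (Laplacian.laplacian f) r) r := fun r =>
    intervalIntegral.integral_hasDerivAt_right (Continuous.intervalIntegrable (by fun_prop) _ _)
      (Continuous.stronglyMeasurableAtFilter (by fun_prop) _ _)
      (Continuous.continuousAt (by fun_prop))
  have hYc : Continuous Y := continuous_iff_continuousAt.2 fun r => (hY r).continuousAt
  have hG1 : ContDiff ℝ 1 G := by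
    rw [contDiff_one_iff_deriv]
    refine ⟨fun t => (hG t).differentiableAt, ?_⟩
    rwa [show deriv G = G' from funext fun t => (hG t).deriv]
  have hGc : Continuous G := hG1.continuous
  set φ : Euc n → ℝ := fun x => G (‖x‖ ^ 2)
  have hφ : ContDiff ℝ 1 φ := hG1.comp (contDiff_norm_sq ℝ)
  have hφc : HasCompactSupport φ := by
    refine HasCompactSupport.intro (isCompact_closedBall (0 : Euc n) b) fun x hx => hsupp _ ?_
    rw [mem_closedBall_zero_iff, not_le] at hx
    gcongr
  have hgreen := integral_mul_laplacian hf hφ hφc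
  have e1 : ∀ x, ∑ i, pd i φ x * pd i f x = 2 * G' (‖x‖ ^ 2) * fderiv ℝ f x x := fun x => by
    rw [← sum_mul_pd f x x, Finset.mul_sum]
    refine Finset.sum_congr rfl fun i _ => ?_
    rw [pd_comp_norm_sq hG]; ring
  simp only [e1] at hgreen
  have hfd : Continuous (fderiv ℝ f) := hf.continuous_fderiv two_ne_zero
  have hi1 : Integrable fun x => φ x * Laplacian.laplacian f x :=
    (hφ.continuous.mul hlap).integrable_of_hasCompactSupport hφc.mul_right
  have hi2 : Integrable fun x : Euc n => 2 * G' (‖x‖ ^ 2) * fderiv ℝ f x x := by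
    refine Continuous.integrable_of_hasCompactSupport (by fun_prop) ?_
    refine HasCompactSupport.intro (isCompact_closedBall (0 : Euc n) b) fun x hx => ?_
    rw [mem_closedBall_zero_iff, not_le] at hx
    rw [hsupp' _ (by gcongr)]; simp
  have s1 : ∀ r, 0 ≤ r → sphInt (fun x => φ x * Laplacian.laplacian f x) r =
      G (r ^ 2) * sphInt (Laplacian.laplacian f) r := fun r hr => by
    unfold sphInt
    rw [← integral_const_mul]
    refine integral_congr_ae (Eventually.of_forall fun σ => ?_)
    have hσ : ‖(σ : Euc n)‖ = 1 := norm_eq_of_mem_sphere σ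
    simp [φ, norm_smul, hσ]
  have s2 : ∀ r, 0 ≤ r → sphInt (fun x => 2 * G' (‖x‖ ^ 2) * fderiv ℝ f x x) r =
      2 * G' (r ^ 2) * r * sphFlux f r := fun r hr => by
    unfold sphInt sphFlux
    rw [← integral_const_mul]
    refine integral_congr_ae (Eventually.of_forall fun σ => ?_)
    have hσ : ‖(σ : Euc n)‖ = 1 := norm_eq_of_mem_sphere σ
    simp [norm_smul, hσ]
    ring
  rw [(integral_polar hn hi1).2, (integral_polar hn hi2).2,
    setIntegral_congr_fun measurableSet_Ioi (g := fun r => r ^ (n - 1) *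
      (G (r ^ 2) * sphInt (Laplacian.laplacian f) r)) fun r hr => by
        simp only [s1 r (le_of_lt hr)],
    setIntegral_congr_fun measurableSet_Ioi (f := fun r => r ^ (n - 1) * sphInt _ r)
      (g := fun r => r ^ (n - 1) * (2 * G' (r ^ 2) * r * sphFlux f r)) fun r hr => by
        simp only [s2 r (le_of_lt hr)],
    integral_Ioi_eq_of_eq_zero hb fun r hr => by rw [hsupp _ (by gcongr)]; ring,
    integral_Ioi_eq_of_eq_zero hb fun r hr => by rw [hsupp' _ (by gcongr)]; ring] at hgreen
  have hF : ∀ r, HasDerivAt (fun r => G (r ^ 2) * Y r)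
      (G' (r ^ 2) * (2 * r) * Y r +
        G (r ^ 2) * (r ^ (n - 1) * sphInt (Laplacian.laplacian f) r)) r := fun r => by
    have h1 := (hG (r ^ 2)).comp r (by simpa using hasDerivAt_pow 2 r :
      HasDerivAt (fun r : ℝ => r ^ 2) (2 * r) r)
    exact h1.mul (hY r)
  have hFTC := intervalIntegral.integral_eq_sub_of_hasDerivAt (a := 0) (b := b)
    (fun r _ => hF r) (Continuous.intervalIntegrable (by fun_prop) _ _)
  have hY0 : Y 0 = 0 := by simp [Y]
  rw [hsupp (b ^ 2) le_rfl, hY0, intervalIntegral.integral_add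
    (Continuous.intervalIntegrable (by fun_prop) _ _)
    (Continuous.intervalIntegrable (by fun_prop) _ _)] at hFTC
  have hsplit : ∀ r, 2 * r * G' (r ^ 2) * (r ^ (n - 1) * sphFlux f r - Y r) =
      r ^ (n - 1) * (2 * G' (r ^ 2) * r * sphFlux f r) - G' (r ^ 2) * (2 * r) * Y r :=
    fun r => by ring
  have hcomm : ∫ r in (0 : ℝ)..b, r ^ (n - 1) * (G (r ^ 2) * sphInt (Laplacian.laplacian f) r) =
      ∫ r in (0 : ℝ)..b, G (r ^ 2) * (r ^ (n - 1) * sphInt (Laplacian.laplacian f) r) := by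
    congr 1; ext r; ring
  change ∫ r in (0 : ℝ)..b, 2 * r * G' (r ^ 2) * (r ^ (n - 1) * sphFlux f r - Y r) = 0
  simp only [hsplit]
  rw [intervalIntegral.integral_sub (Continuous.intervalIntegrable (by fun_prop) _ _)
    (Continuous.intervalIntegrable (by fun_prop) _ _)]
  linarith

/-- The divergence theorem on balls: the flux of `∇f` through a sphere. -/
theorem sphFlux_eq (hn : n ≠ 0) {f : Euc n → ℝ} (hf : ContDiff ℝ 2 f) {r : ℝ} (hr : 0 < r) :
    r ^ (n - 1) * sphFlux f r =
      ∫ s in (0 : ℝ)..r, s ^ (n - 1) * sphInt (Laplacian.laplacian f) s := by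
  have hlap := continuous_laplacian hf
  have hSl := continuous_sphInt hlap
  have hflux := continuous_sphFlux (hf.of_le (by norm_num : (1 : ℕ∞ω) ≤ 2))
  set J : ℝ → ℝ := fun r => r ^ (n - 1) * sphFlux f r -
    ∫ s in (0 : ℝ)..r, s ^ (n - 1) * sphInt (Laplacian.laplacian f) s
  have hJ : Continuous J := by
    have : Continuous fun r => ∫ s in (0 : ℝ)..r, s ^ (n - 1) * sphInt (Laplacian.laplacian f) s :=
      intervalIntegral.continuous_primitive (fun a b =>
        Continuous.intervalIntegrable (by fun_prop) _ _) 0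
    fun_prop
  suffices h : ∀ᵐ x : ℝ, x ∈ Set.Ioi (0 : ℝ) → J x = 0 by
    have h2 : Set.EqOn J 0 (Set.Ioi 0) := by
      refine Measure.eqOn_open_of_ae_eq (μ := volume) ?_ isOpen_Ioi hJ.continuousOn
        continuousOn_const
      exact (ae_restrict_iff' measurableSet_Ioi).2 h
    exact sub_eq_zero.1 (h2 hr)
  refine isOpen_Ioi.ae_eq_zero_of_integral_contDiff_smul_eq_zero
    (hJ.locallyIntegrable.locallyIntegrableOn _) fun g hg hgc hgs => ?_
  obtain ⟨b, hb⟩ := hgc.isCompact.isBounded.subset_closedBall 0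
  have hb' : ∀ r, |b| < r → g r = 0 := fun r hr => by
    by_contra hne
    have := hb (subset_tsupport g hne)
    rw [mem_closedBall_zero_iff, Real.norm_eq_abs] at this
    have h1 := le_abs_self r
    have h2 := le_abs_self b
    linarith
  set B := |b| + 1
  have hB : 0 < B := by positivity
  have hg0 : ∀ r, r ≤ 0 → g r = 0 := fun r hr => by
    by_contra hne
    exact absurd (hgs (subset_tsupport g hne)) (not_lt.2 hr)
  have hgB : ∀ r, B ≤ r → g r = 0 := fun r hr => hb' r (by simp only [B] at hr; linarith)
  -- The support of `g` is a closed subset of `(0, ∞)`, so division by `r` does no harm at `0`.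
  have hq : Continuous fun r => g r / (2 * r) := by
    rw [continuous_iff_continuousAt]
    intro r
    by_cases h : r ∈ tsupport g
    · have : r ≠ 0 := (hgs h).ne'
      exact hg.continuous.continuousAt.div (by fun_prop) (by simpa using this)
    · have h1 : g =ᶠ[𝓝 r] 0 := notMem_tsupport_iff_eventuallyEq.1 h
      have h2 : (fun r => g r / (2 * r)) =ᶠ[𝓝 r] fun _ => 0 := by
        filter_upwards [h1] with s hs
        simp [hs]
      exact continuousAt_const.congr h2.symm
  -- Chosen so that `2 r G'(r²) = g(r)` for `r ≥ 0`. The weak identity then becomes `∫ g J = 0` for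
  -- every test function `g`.
  set G' : ℝ → ℝ := fun t => g (Real.sqrt t) / (2 * Real.sqrt t)
  have hG' : Continuous G' := hq.comp Real.continuous_sqrt
  set G : ℝ → ℝ := fun t => ∫ u in (B ^ 2)..t, G' u
  have hG : ∀ t, HasDerivAt G (G' t) t := fun t =>
    intervalIntegral.integral_hasDerivAt_right (hG'.intervalIntegrable _ _)
      (hG'.stronglyMeasurableAtFilter _ _) hG'.continuousAt
  have hz' : ∀ t, B ^ 2 ≤ t → G' t = 0 := fun t ht => by
    have : B ≤ Real.sqrt t := Real.le_sqrt_of_sq_le ht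
    simp [G', hgB _ this]
  have hz : ∀ t, B ^ 2 ≤ t → G t = 0 := fun t ht => by
    simp only [G]
    rw [intervalIntegral.integral_congr (g := fun _ => 0)]
    · simp
    · intro u hu
      rw [Set.uIcc_of_le ht] at hu
      exact hz' u hu.1
  have hweak := sphFlux_weak hn hf hG hG' hB.le hz hz'
  have hpt : ∀ r, 0 ≤ r → 2 * r * G' (r ^ 2) * J r = g r * J r := fun r hr => by
    simp only [G', Real.sqrt_sq hr]
    rcases hr.eq_or_lt with rfl | h
    · simp [hg0 0 le_rfl]
    · field_simp
  have hIoi : ∫ r, g r • J r = ∫ r in Set.Ioi 0, g r * J r :=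
    (setIntegral_eq_integral_of_forall_compl_eq_zero fun r hr => by
      simp [hg0 r (not_lt.1 hr)]).symm
  rw [hIoi, integral_Ioi_eq_of_eq_zero hB.le fun r hr => by rw [hgB r hr, zero_mul]]
  refine Eq.trans (intervalIntegral.integral_congr ?_) hweak
  intro r hr
  rw [Set.uIcc_of_le hB.le] at hr
  exact (hpt r hr.1).symm

/-- The link between consecutive means of the functions `(-Δ)^j w`. -/
theorem sphInt_hasDerivAt_of_pos (hn : n ≠ 0) {f : Euc n → ℝ} (hf : ContDiff ℝ 2 f) {r : ℝ}
    (hr : 0 < r) : HasDerivAt (sphInt f) ((∫ s in (0 : ℝ)..r,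
      s ^ (n - 1) * sphInt (Laplacian.laplacian f) s) / r ^ (n - 1)) r := by
  rw [← sphFlux_eq hn hf hr, mul_div_cancel_left₀ _ (pow_pos hr _).ne']
  exact hasDerivAt_sphInt (hf.of_le (by norm_num)) r

end SphericalMeans

/-! ### Asymptotics of the radial hierarchy `W_j' = -r^{1-n} ∫_0^r s^{n-1} W_{j+1}`. -/

section RadialAsymptotics

/-- L'Hôpital's rule for a denominator tending to infinity. -/
theorem tendsto_div_of_deriv_div {f f' g g' : ℝ → ℝ} {L : ℝ}
    (hf : ∀ᶠ x in atTop, HasDerivAt f (f' x) x) (hg : ∀ᶠ x in atTop, HasDerivAt g (g' x) x)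
    (hg' : ∀ᶠ x in atTop, 0 < g' x) (hgtop : Tendsto g atTop atTop)
    (h : Tendsto (fun x => f' x / g' x) atTop (𝓝 L)) :
    Tendsto (fun x => f x / g x) atTop (𝓝 L) := by
  have upper : ∀ {f f' : ℝ → ℝ} {L : ℝ}, (∀ᶠ x in atTop, HasDerivAt f (f' x) x) →
      Tendsto (fun x => f' x / g' x) atTop (𝓝 L) → ∀ M > L, ∀ᶠ x in atTop, f x / g x < M := by
    intro f f' L hf h M hM
    obtain ⟨N, hLN, hNM⟩ := exists_between hM
    obtain ⟨R, hR⟩ := (((hf.and hg).and hg').and (h.eventually (gt_mem_nhds hLN))).exists_forall_of_atTop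
    -- Beyond `R` one has `f' < N g'`, so `f - N g` stays below its value at `R`; dividing by `g →
    -- ∞` removes that constant.
    have hanti : AntitoneOn (fun x => f x - N * g x) (Set.Ici R) := by
      refine antitoneOn_of_hasDerivWithinAt_nonpos (f' := fun x => f' x - N * g' x)
        (convex_Ici R) ?_ ?_ ?_
      · exact fun x hx => ((hR x hx).1.1.1.sub
          ((hR x hx).1.1.2.const_mul N)).continuousAt.continuousWithinAt
      · intro x hx
        rw [interior_Ici] at hx
        exact ((hR x hx.le).1.1.1.sub ((hR x hx.le).1.1.2.const_mul N)).hasDerivWithinAt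
      · intro x hx
        rw [interior_Ici] at hx
        obtain ⟨⟨-, h1⟩, h2⟩ := hR x hx.le
        rw [div_lt_iff₀ h1] at h2
        linarith
    have hC : Tendsto (fun x => N + (f R - N * g R) / g x) atTop (𝓝 (N + 0)) :=
      (hgtop.const_div_atTop _).const_add N
    rw [add_zero] at hC
    filter_upwards [hC.eventually (gt_mem_nhds hNM), eventually_ge_atTop R,
      hgtop.eventually_gt_atTop 0] with x h1 h2 h3
    refine lt_of_le_of_lt ?_ h1
    have h4 := hanti (Set.mem_Ici.2 le_rfl) (Set.mem_Ici.2 h2) h2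
    simp only at h4
    rw [div_le_iff₀ h3, add_mul, div_mul_cancel₀ _ h3.ne']
    linarith
  refine tendsto_order.2 ⟨fun M hM => ?_, fun M hM => upper hf h M hM⟩
  have h2 := upper (f := fun x => -f x) (f' := fun x => -f' x) (L := -L)
    (hf.mono fun x hx => hx.neg) (by simpa [neg_div] using h.neg) (-M) (by linarith)
  filter_upwards [h2] with x hx
  rw [neg_div] at hx
  linarith

/-- A function whose derivative is `O(r⁻²)` converges at infinity. -/
theorem exists_tendsto_of_deriv_bound {V V' : ℝ → ℝ} {C : ℝ} (hC : 0 ≤ C)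
    (hV : ∀ᶠ r in atTop, HasDerivAt V (V' r) r) (hb : ∀ᶠ r in atTop, |V' r| ≤ C / r ^ 2) :
    ∃ c, Tendsto V atTop (𝓝 c) := by
  obtain ⟨R, hR⟩ := ((hV.and hb).and (eventually_gt_atTop 0)).exists_forall_of_atTop
  have hinv : ∀ r : ℝ, R ≤ r → HasDerivAt (fun r => C / r) (-(C / r ^ 2)) r := fun r hr => by
    have h := (hasDerivAt_inv (hR r hr).2.ne').const_mul C
    have e : -(C / r ^ 2) = C * -(r ^ 2)⁻¹ := by ring
    rw [e]
    exact h
  -- `V - C/r` increases while `V + C/r` decreases, so the first is bounded above and converges.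
  have hmono : MonotoneOn (fun r => V r - C / r) (Set.Ici R) := by
    refine monotoneOn_of_hasDerivWithinAt_nonneg (f' := fun r => V' r - -(C / r ^ 2))
      (convex_Ici R) ?_ ?_ ?_
    · exact fun x hx => ((hR x hx).1.1.sub (hinv x hx)).continuousAt.continuousWithinAt
    · intro x hx
      rw [interior_Ici] at hx
      exact ((hR x hx.le).1.1.sub (hinv x hx.le)).hasDerivWithinAt
    · intro x hx
      rw [interior_Ici] at hx
      have := neg_le_of_abs_le (hR x hx.le).1.2
      linarith
  have hanti : AntitoneOn (fun r => V r + C / r) (Set.Ici R) := by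
    refine antitoneOn_of_hasDerivWithinAt_nonpos (f' := fun r => V' r + -(C / r ^ 2))
      (convex_Ici R) ?_ ?_ ?_
    · exact fun x hx => ((hR x hx).1.1.add (hinv x hx)).continuousAt.continuousWithinAt
    · intro x hx
      rw [interior_Ici] at hx
      exact ((hR x hx.le).1.1.add (hinv x hx.le)).hasDerivWithinAt
    · intro x hx
      rw [interior_Ici] at hx
      have := le_of_abs_le (hR x hx.le).1.2
      linarith
  -- Freezing the function to the left of `R` makes it monotone on the whole line.
  set U : ℝ → ℝ := fun r => V (max r R) - C / max r R
  have hU : Monotone U := fun a b hab =>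
    hmono (le_max_right a R) (le_max_right b R) (max_le_max_right R hab)
  have hUb : BddAbove (Set.range U) := by
    refine ⟨V R + C / R, ?_⟩
    rintro _ ⟨r, rfl⟩
    have h1 := hanti (Set.mem_Ici.2 le_rfl) (le_max_right r R) (le_max_right r R)
    have h2 : 0 ≤ C / max r R := div_nonneg hC (hR _ (le_max_right r R)).2.le
    simp only [U] at h1 ⊢
    linarith
  refine ⟨_, ((tendsto_atTop_ciSup hU hUb).add (tendsto_id.const_div_atTop C)).congr' ?_⟩
  filter_upwards [eventually_ge_atTop R] with r hr
  simp [U, max_eq_left hr]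

theorem hasDerivAt_primitive {U : ℝ → ℝ} (hU : Continuous U) (k : ℕ) (r : ℝ) :
    HasDerivAt (fun r => ∫ s in (0 : ℝ)..r, s ^ k * U s) (r ^ k * U r) r :=
  intervalIntegral.integral_hasDerivAt_right (Continuous.intervalIntegrable (by fun_prop) _ _)
    (Continuous.stronglyMeasurableAtFilter (by fun_prop) _ _)
    (Continuous.continuousAt (by fun_prop))

theorem tendsto_primitive_div {U : ℝ → ℝ} (hU : Continuous U) {k q : ℕ} (hq : 0 < q) {K : ℝ}
    (h : Tendsto (fun r => r ^ k * U r / r ^ (q - 1)) atTop (𝓝 K)) :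
    Tendsto (fun r => (∫ s in (0 : ℝ)..r, s ^ k * U s) / r ^ q) atTop (𝓝 (K / q)) := by
  have hq' : (q : ℝ) ≠ 0 := by positivity
  have h1 := tendsto_div_of_deriv_div (L := K / q)
    (Eventually.of_forall fun r => hasDerivAt_primitive hU k r)
    (Eventually.of_forall fun r => hasDerivAt_pow q r)
    (by filter_upwards [eventually_gt_atTop 0] with r hr; positivity)
    (tendsto_pow_atTop hq.ne') ?_
  · exact h1
  · refine (h.div_const (q : ℝ)).congr fun r => ?_
    rw [div_div, mul_comm (q : ℝ)]

section Hierarchy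

variable {m : ℕ} {W : ℕ → ℝ → ℝ}

/-- Polynomial growth propagates down the hierarchy. -/
theorem growth_step (hm : 1 ≤ m) (hW : ∀ j ≤ m, Continuous (W j))
    (hd : ∀ j < m, ∀ r, 0 < r → HasDerivAt (W j)
      (-((∫ s in (0 : ℝ)..r, s ^ (2 * m - 1) * W (j + 1) s) / r ^ (2 * m - 1))) r)
    {j : ℕ} (hj : j < m) {p : ℕ} {C : ℝ}
    (h : Tendsto (fun r => W (j + 1) r / r ^ (2 * p)) atTop (𝓝 C)) :
    Tendsto (fun r => deriv (W j) r / r ^ (2 * p + 1)) atTop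
      (𝓝 (-(C / ((2 * m + 2 * p : ℕ) : ℝ)))) ∧
    Tendsto (fun r => W j r / r ^ (2 * (p + 1))) atTop
      (𝓝 (-(C / ((2 * m + 2 * p : ℕ) : ℝ)) / ((2 * (p + 1) : ℕ) : ℝ))) := by
  have h1 : Tendsto (fun r => (∫ s in (0 : ℝ)..r, s ^ (2 * m - 1) * W (j + 1) s) /
      r ^ (2 * m + 2 * p)) atTop (𝓝 (C / ((2 * m + 2 * p : ℕ) : ℝ))) := by
    refine tendsto_primitive_div (hW _ hj) (by omega) (h.congr' ?_)
    filter_upwards [eventually_gt_atTop 0] with r hr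
    rw [show 2 * m + 2 * p - 1 = (2 * m - 1) + 2 * p by omega, pow_add]
    field_simp
  have h2 : Tendsto (fun r => deriv (W j) r / r ^ (2 * p + 1)) atTop
      (𝓝 (-(C / ((2 * m + 2 * p : ℕ) : ℝ)))) := by
    refine h1.neg.congr' ?_
    filter_upwards [eventually_gt_atTop 0] with r hr
    rw [(hd j hj r hr).deriv, neg_div, div_div, ← pow_add]
    congr 3
    omega
  refine ⟨h2, ?_⟩
  refine tendsto_div_of_deriv_div (f' := deriv (W j))
    (g' := fun r => ((2 * (p + 1) : ℕ) : ℝ) * r ^ (2 * (p + 1) - 1)) ?_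
    (Eventually.of_forall fun r => hasDerivAt_pow _ r) ?_ (tendsto_pow_atTop (by omega)) ?_
  · filter_upwards [eventually_gt_atTop 0] with r hr
    exact (hd j hj r hr).differentiableAt.hasDerivAt
  · filter_upwards [eventually_gt_atTop 0] with r hr
    positivity
  · refine (h2.div_const ((2 * (p + 1) : ℕ) : ℝ)).congr fun r => ?_
    rw [div_div, mul_comm, show 2 * (p + 1) - 1 = 2 * p + 1 by omega]

/-- If `C ≠ 0`, each step down the hierarchy keeps the leading coefficient nonzero and raises the
power by two, until `W_1 ~ C r^{2p}` and `W_0' ~ -c r^{2p+1}` with `c ≠ 0`. Dividing `κ (W_0')² ≤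
W_1` by `r^{4p+2}` then gives `κ c² ≤ 0`. -/
theorem no_growth (hm : 1 ≤ m) (hW : ∀ j ≤ m, Continuous (W j))
    (hd : ∀ j < m, ∀ r, 0 < r → HasDerivAt (W j)
      (-((∫ s in (0 : ℝ)..r, s ^ (2 * m - 1) * W (j + 1) s) / r ^ (2 * m - 1))) r)
    {κ : ℝ} (hκ : 0 < κ) (hpos : ∀ᶠ r in atTop, κ * deriv (W 0) r ^ 2 ≤ W 1 r)
    {j : ℕ} (hj : j < m) (p : ℕ) {C : ℝ}
    (h : Tendsto (fun r => W (j + 1) r / r ^ (2 * p)) atTop (𝓝 C)) : C = 0 := by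
  induction j generalizing p C with
  | zero =>
    by_contra hC
    have h1 := (growth_step hm hW hd hj h).1
    set c := C / ((2 * m + 2 * p : ℕ) : ℝ)
    have hc : c ≠ 0 := div_ne_zero hC (by positivity)
    have h2 : Tendsto (fun r => κ * (deriv (W 0) r / r ^ (2 * p + 1)) ^ 2) atTop
        (𝓝 (κ * (-c) ^ 2)) := (h1.pow 2).const_mul κ
    have h3 : Tendsto (fun r : ℝ => W 1 r / r ^ (2 * p) * (r ^ (2 * p + 2))⁻¹) atTop (𝓝 (C * 0)) :=
      h.mul (tendsto_inv_atTop_zero.comp (tendsto_pow_atTop (by omega)))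
    have h4 := le_of_tendsto_of_tendsto h2 h3 (by
      filter_upwards [hpos, eventually_gt_atTop 0] with r hr hr0
      rw [div_pow, ← mul_div_assoc, ← div_eq_mul_inv, div_div, ← pow_add, ← pow_mul]
      rw [show (2 * p + 1) * 2 = 2 * p + (2 * p + 2) by ring]
      gcongr)
    have : 0 < κ * (-c) ^ 2 := by
      rw [neg_sq]
      positivity
    linarith
  | succ j ih =>
    have h1 := ih (by omega) (p + 1) (growth_step hm hW hd (by omega : j + 1 < m) h).2
    rw [div_eq_zero_iff, neg_eq_zero, div_eq_zero_iff] at h1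
    have e1 : ((2 * m + 2 * p : ℕ) : ℝ) ≠ 0 := by positivity
    have e2 : ((2 * (p + 1) : ℕ) : ℝ) ≠ 0 := by positivity
    tauto

/-- The hypothesis says `W_i' ~ -K r^{-(2i+1)}`, so `W_i` converges, and its limit is zero by
`no_growth` with `p = 0`. L'Hôpital's rule then gives `W_i ~ (K / 2i) r^{-2i}`, and integrating
against `s^{2m-1}` contributes the factor `1 / (2(m-i))`. -/
theorem decay_step (hm : 1 ≤ m) (hW : ∀ j ≤ m, Continuous (W j))
    (hd : ∀ j < m, ∀ r, 0 < r → HasDerivAt (W j)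
      (-((∫ s in (0 : ℝ)..r, s ^ (2 * m - 1) * W (j + 1) s) / r ^ (2 * m - 1))) r)
    {κ : ℝ} (hκ : 0 < κ) (hpos : ∀ᶠ r in atTop, κ * deriv (W 0) r ^ 2 ≤ W 1 r)
    {i : ℕ} (hi : 1 ≤ i) (him : i < m) {K : ℝ}
    (h : Tendsto (fun r => (∫ s in (0 : ℝ)..r, s ^ (2 * m - 1) * W (i + 1) s) /
      r ^ (2 * m - 2 * (i + 1))) atTop (𝓝 K)) :
    Tendsto (fun r => (∫ s in (0 : ℝ)..r, s ^ (2 * m - 1) * W i s) /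
      r ^ (2 * m - 2 * i)) atTop (𝓝 (K / ((2 * i : ℕ) * (2 * (m - i) : ℕ) : ℝ))) := by
  have hVd : ∀ᶠ r in atTop, HasDerivAt (W i) (deriv (W i) r) r := by
    filter_upwards [eventually_gt_atTop 0] with r hr
    exact (hd i him r hr).differentiableAt.hasDerivAt
  have h1 : Tendsto (fun r => deriv (W i) r * r ^ (2 * i + 1)) atTop (𝓝 (-K)) := by
    refine h.neg.congr' ?_
    filter_upwards [eventually_gt_atTop 0] with r hr
    rw [(hd i him r hr).deriv, show 2 * m - 1 = (2 * m - 2 * (i + 1)) + (2 * i + 1) by omega,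
      pow_add, neg_mul]
    field_simp
  obtain ⟨c, hc⟩ : ∃ c, Tendsto (W i) atTop (𝓝 c) := by
    refine exists_tendsto_of_deriv_bound (C := |K| + 1) (by positivity) hVd ?_
    have h2 : ∀ᶠ r in atTop, |deriv (W i) r * r ^ (2 * i + 1)| < |K| + 1 := by
      have := h1.abs
      rw [abs_neg] at this
      exact this.eventually (gt_mem_nhds (by linarith))
    filter_upwards [h2, eventually_ge_atTop 1] with r h2 hr
    have hr0 : 0 < r := by linarith
    rw [le_div_iff₀ (by positivity)]
    refine le_trans ?_ h2.le
    rw [abs_mul, abs_of_pos (pow_pos hr0 _)]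
    gcongr
    omega
  have hc0 : c = 0 := by
    obtain ⟨k, rfl⟩ : ∃ k, i = k + 1 := ⟨i - 1, by omega⟩
    exact no_growth hm hW hd hκ hpos (by omega : k < m) 0 (by simpa using hc)
  subst hc0
  have hi2 : ((2 * i : ℕ) : ℝ) ≠ 0 := by positivity
  have h3 : Tendsto (fun r => W i r / (r ^ (2 * i))⁻¹) atTop (𝓝 (K / (2 * i : ℕ))) := by
    refine HasDerivAt.lhopital_zero_atTop (f' := deriv (W i))
      (g' := fun r => -(((2 * i : ℕ) : ℝ) * r ^ (2 * i - 1)) / (r ^ (2 * i)) ^ 2) hVd ?_ ?_ hc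
      (tendsto_inv_atTop_zero.comp (tendsto_pow_atTop (by omega))) ?_
    · filter_upwards [eventually_gt_atTop 0] with r hr
      exact (hasDerivAt_pow (2 * i) r).inv (by positivity)
    · filter_upwards [eventually_gt_atTop 0] with r hr
      have : 0 < ((2 * i : ℕ) : ℝ) * r ^ (2 * i - 1) := by positivity
      exact div_ne_zero (by linarith) (by positivity)
    · have h4 := h1.neg.div_const ((2 * i : ℕ) : ℝ)
      rw [neg_neg] at h4
      refine h4.congr' ?_
      filter_upwards [eventually_gt_atTop 0] with r hr
      have e : (r ^ (2 * i)) ^ 2 = r ^ (2 * i + 1) * r ^ (2 * i - 1) := by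
        rw [← pow_mul, ← pow_add]; congr 1; omega
      rw [e]
      field_simp
  rw [← div_div, show 2 * m - 2 * i = 2 * (m - i) by omega]
  refine tendsto_primitive_div (hW _ him.le) (by omega) (h3.congr' ?_)
  filter_upwards [eventually_gt_atTop 0] with r hr
  rw [show 2 * m - 1 = 2 * i + (2 * (m - i) - 1) by omega, pow_add]
  field_simp

/-- The two factors run through `2, 4, …, 2m-2`, once upwards and once downwards. This is the origin
of `((n-2)‼)²` in the constant. -/
theorem prod_two_mul_reflect (m : ℕ) (hm : 1 ≤ m) :
    ∏ i ∈ Finset.Ico 1 m, ((2 * i : ℕ) * (2 * (m - i) : ℕ) : ℝ) =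
      ((2 * m - 2).doubleFactorial : ℝ) ^ 2 := by
  obtain ⟨k, rfl⟩ : ∃ k, m = k + 1 := ⟨m - 1, by omega⟩
  have h1 : (2 * (k + 1) - 2).doubleFactorial = ∏ i ∈ Finset.range k, 2 * (i + 1) := by
    rw [show 2 * (k + 1) - 2 = 2 * k by omega, Nat.doubleFactorial_eq_prod_even]
  rw [Finset.prod_mul_distrib, Finset.prod_Ico_eq_prod_range, Finset.prod_Ico_eq_prod_range, h1,
    Nat.cast_prod, sq]
  congr 1
  · exact Finset.prod_congr rfl fun i _ => by rw [add_comm 1 i]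
  · rw [← Finset.prod_range_reflect]
    refine Finset.prod_congr (by simp) fun i hi => ?_
    have : i < k := by simpa using hi
    congr 2
    omega

/-- The logarithmic slope of the bottom function of the hierarchy. -/
theorem tendsto_mul_deriv_hierarchy (hm : 1 ≤ m) (hW : ∀ j ≤ m, Continuous (W j))
    (hd : ∀ j < m, ∀ r, 0 < r → HasDerivAt (W j)
      (-((∫ s in (0 : ℝ)..r, s ^ (2 * m - 1) * W (j + 1) s) / r ^ (2 * m - 1))) r)
    (hpos : 2 ≤ m → ∃ κ : ℝ, 0 < κ ∧ ∀ᶠ r in atTop, κ * deriv (W 0) r ^ 2 ≤ W 1 r) {γ : ℝ}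
    (hγ : Tendsto (fun r => ∫ s in (0 : ℝ)..r, s ^ (2 * m - 1) * W m s) atTop (𝓝 γ)) :
    Tendsto (fun r => r * deriv (W 0) r) atTop
      (𝓝 (-(γ / ((2 * m - 2).doubleFactorial : ℝ) ^ 2))) := by
  -- Induction downwards from the top level `m`, where the claim is `hγ`, to level `1`, which
  -- determines `W_0'`.
  have key : ∀ d, d < m → Tendsto (fun r => (∫ s in (0 : ℝ)..r, s ^ (2 * m - 1) * W (m - d) s) /
      r ^ (2 * m - 2 * (m - d))) atTop
      (𝓝 (γ / ∏ i ∈ Finset.Ico (m - d) m, ((2 * i : ℕ) * (2 * (m - i) : ℕ) : ℝ))) := by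
    intro d
    induction d with
    | zero => intro _; simpa using hγ
    | succ d ih =>
      intro hdm
      obtain ⟨κ, hκ, hp⟩ := hpos (by omega)
      have h1 := ih (by omega)
      have e : m - d = (m - (d + 1)) + 1 := by omega
      rw [e] at h1
      have h2 := decay_step hm hW hd hκ hp (by omega : 1 ≤ m - (d + 1)) (by omega) h1
      rw [div_div] at h2
      rw [Finset.prod_eq_prod_Ico_succ_bot (by omega),
        mul_comm (((2 * (m - (d + 1)) : ℕ) : ℝ) * _)]
      exact h2
  have h1 := key (m - 1) (by omega)
  rw [show m - (m - 1) = 1 by omega, prod_two_mul_reflect m hm] at h1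
  refine h1.neg.congr' ?_
  filter_upwards [eventually_gt_atTop 0] with r hr
  rw [(hd 0 hm r hr).deriv, show 2 * m - 1 = (2 * m - 2 * 1) + 1 by omega, pow_succ]
  field_simp

end Hierarchy

end RadialAsymptotics

/-! ### Scalar curvature of `e^{2w} g₀`. -/

section ScalarCurvature

variable {n : ℕ}

open MetricField

/-- The Kronecker delta. -/
noncomputable abbrev kron (i j : Fin n) : ℝ := if i = j then 1 else 0

theorem pd_conformalMetric {w : Euc n → ℝ} (hw : Differentiable ℝ w) (i j l : Fin n) (x : Euc n) :
    pd i (fun y => conformalMetric w y j l) x =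
      2 * Real.exp (2 * w x) * pd i w x * kron j l := by
  have h1 : HasFDerivAt (fun y => Real.exp (2 * w y) * (1 : Matrix (Fin n) (Fin n) ℝ) j l)
      (((1 : Matrix (Fin n) (Fin n) ℝ) j l) • (Real.exp (2 * w x) • ((2 : ℝ) • fderiv ℝ w x))) x :=
    (((hw x).hasFDerivAt.const_mul 2).exp).mul_const _
  have h2 : (fun y => conformalMetric w y j l) =
      fun y => Real.exp (2 * w y) * (1 : Matrix (Fin n) (Fin n) ℝ) j l := by
    ext y; simp [conformalMetric]
  unfold pd
  rw [h2, h1.fderiv]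
  by_cases h : j = l
  · subst h; simp; ring
  · simp [h]

theorem conformalMetric_inv_apply (w : Euc n → ℝ) (x : Euc n) (k l : Fin n) :
    (conformalMetric w x)⁻¹ k l = Real.exp (-(2 * w x)) * kron k l := by
  have h : (conformalMetric w x)⁻¹ = Real.exp (-(2 * w x)) • (1 : Matrix (Fin n) (Fin n) ℝ) := by
    refine Matrix.inv_eq_right_inv ?_
    simp [conformalMetric, smul_smul, ← Real.exp_add]
  rw [h]
  simp [Matrix.one_apply]

theorem christoffel_conformalMetric {w : Euc n → ℝ} (hw : Differentiable ℝ w) (k i j : Fin n)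
    (x : Euc n) : christoffel (conformalMetric w) k i j x =
      kron k j * pd i w x + kron k i * pd j w x - kron i j * pd k w x := by
  unfold christoffel
  simp only [pd_conformalMetric hw, conformalMetric_inv_apply]
  rw [Finset.sum_eq_single k]
  · have h : Real.exp (-(2 * w x)) * Real.exp (2 * w x) = 1 := by
      rw [← Real.exp_add]; simp
    have e1 : kron j k = kron k j := by simp [kron, eq_comm]
    have e2 : kron i k = kron k i := by simp [kron, eq_comm]
    rw [e1, e2]
    simp only [kron, if_true]
    linear_combination ((if k = j then 1 else 0) * pd i w x + (if k = i then 1 else 0) * pd j w x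
      - (if i = j then 1 else 0) * pd k w x) * h
  · intro l _ hl
    simp [kron, hl.symm]
  · simp

theorem pd_christoffel {w : Euc n → ℝ} (hw : ContDiff ℝ 2 w) (q k i j : Fin n)
    (x : Euc n) : pd q (christoffel (conformalMetric w) k i j) x =
      kron k j * pd q (pd i w) x + kron k i * pd q (pd j w) x - kron i j * pd q (pd k w) x := by
  have h0 : christoffel (conformalMetric w) k i j = fun x =>
      kron k j * pd i w x + kron k i * pd j w x - kron i j * pd k w x :=
    funext fun x => christoffel_conformalMetric (hw.differentiable two_ne_zero) k i j x
  have hd : ∀ i, HasFDerivAt (pd i w) (fderiv ℝ (pd i w) x) x := fun i =>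
    ((contDiff_pd (k := 1) hw (by norm_num) i).differentiable one_ne_zero x).hasFDerivAt
  rw [h0]
  unfold pd at hd ⊢
  have h1 := ((((hd i).const_mul (kron k j)).add ((hd j).const_mul (kron k i))).sub
    ((hd k).const_mul (kron i j))).fderiv
  refine (congrArg (fun L => L (EuclideanSpace.single q (1 : ℝ))) h1).trans ?_
  simp only [sub_apply, add_apply,
    smul_apply, smul_eq_mul]

/-- The inverse metric is diagonal, so the diagonal entries suffice for the scalar curvature. -/
theorem ricci_diag {w : Euc n → ℝ} (hw : ContDiff ℝ 2 w) (i : Fin n) (x : Euc n) :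
    ricci (conformalMetric w) i i x =
      (2 - (n : ℝ)) * pd i (pd i w) x - ∑ k, pd k (pd k w) x
        + (2 - n) * (∑ k, pd k w x ^ 2) - (2 - n) * pd i w x ^ 2 := by
  have hd := hw.differentiable two_ne_zero
  unfold ricci
  simp only [pd_christoffel hw, christoffel_conformalMetric hd]
  have h1 : ∑ k, (kron k i * pd k (pd i w) x + kron k i * pd k (pd i w) x -
      kron i i * pd k (pd k w) x - (kron k k * pd i (pd i w) x + kron k i * pd i (pd k w) x -
      kron i k * pd i (pd k w) x)) =
      2 * pd i (pd i w) x - ∑ k, pd k (pd k w) x - n * pd i (pd i w) x := by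
    have : ∀ k, (kron k i * pd k (pd i w) x + kron k i * pd k (pd i w) x -
      kron i i * pd k (pd k w) x - (kron k k * pd i (pd i w) x + kron k i * pd i (pd k w) x -
      kron i k * pd i (pd k w) x)) =
      (if k = i then 2 * pd k (pd i w) x else 0) - pd k (pd k w) x - pd i (pd i w) x := fun k => by
      by_cases h : k = i
      · subst h; simp [kron]; ring
      · simp [kron, h, Ne.symm h]
    simp only [this, Finset.sum_sub_distrib, Finset.sum_ite_eq', Finset.mem_univ, if_true,
      Finset.sum_const, Finset.card_univ, Fintype.card_fin, nsmul_eq_mul]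
  -- The products of Kronecker deltas become a combination of single indicators, checked by cases on
  -- the coincidences among `i`, `k`, `l`; the double sum then collapses.
  have h2 : ∀ k l : Fin n, ((kron k l * pd k w x + kron k k * pd l w x - kron k l * pd k w x) *
      (kron l i * pd i w x + kron l i * pd i w x - kron i i * pd l w x) -
      (kron k l * pd i w x + kron k i * pd l w x - kron i l * pd k w x) *
      (kron l k * pd i w x + kron l i * pd k w x - kron i k * pd l w x)) =
      (if l = i then 2 * pd i w x ^ 2 else 0) - pd l w x ^ 2
        - (if k = l then pd i w x ^ 2 else 0) + (if k = i then pd l w x ^ 2 else 0)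
        + (if l = i then pd k w x ^ 2 else 0)
        - (if k = i then if l = i then 2 * pd i w x ^ 2 else 0 else 0) := fun k l => by
    by_cases h : k = i
    · subst h
      by_cases h' : l = k
      · subst h'; simp [kron]
      · simp [kron, h', Ne.symm h']
    · by_cases h' : l = i
      · subst h'; simp [kron, h, Ne.symm h]; ring
      · by_cases h'' : k = l
        · subst h''; simp [kron, h, Ne.symm h]; ring
        · simp [kron, h, h', h'', Ne.symm h, Ne.symm h', Ne.symm h'']; ring
  rw [h1]
  simp only [h2, Finset.sum_sub_distrib, Finset.sum_add_distrib, Finset.sum_ite_eq',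
    Finset.sum_ite_eq, Finset.mem_univ, if_true, Finset.sum_const, Finset.card_univ,
    Fintype.card_fin, nsmul_eq_mul]
  have h3 : ∑ k : Fin n, ∑ l, (if k = i then pd l w x ^ 2 else 0) = ∑ l, pd l w x ^ 2 := by
    rw [Finset.sum_eq_single i] <;> simp +contextual
  have h4 : ∑ k : Fin n, ∑ l, (if k = i then if l = i then 2 * pd i w x ^ 2 else 0 else 0) =
      2 * pd i w x ^ 2 := by
    rw [Finset.sum_eq_single i] <;> simp +contextual
  rw [h3, h4]
  ring

theorem scalarCurvature_conformalMetric {w : Euc n → ℝ} (hw : ContDiff ℝ 2 w) (x : Euc n) :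
    scalarCurvature (conformalMetric w) x = -(Real.exp (-(2 * w x)) * ((n : ℝ) - 1) *
      (2 * Laplacian.laplacian w x + ((n : ℝ) - 2) * ∑ k, pd k w x ^ 2)) := by
  unfold scalarCurvature
  simp only [conformalMetric_inv_apply]
  have h1 : ∀ i, ∑ j, Real.exp (-(2 * w x)) * kron i j * ricci (conformalMetric w) i j x =
      Real.exp (-(2 * w x)) * ricci (conformalMetric w) i i x := fun i => by
    rw [Finset.sum_eq_single i]
    · simp
    · intro j _ hj; simp [kron, hj.symm]
    · simp
  simp only [h1, ← Finset.mul_sum, ricci_diag hw, laplacian_eq_sum_pd hw, Finset.sum_sub_distrib,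
    Finset.sum_add_distrib, Finset.sum_const, Finset.card_univ, Fintype.card_fin, nsmul_eq_mul]
  ring

/-- Non-negative scalar curvature of `e^{2w} g₀` in terms of `w`. -/
theorem laplacian_add_grad_sq_nonpos {m : ℕ} (hm : 1 ≤ m) {w : Euc (2 * m) → ℝ}
    (hw : ContDiff ℝ 2 w) {x : Euc (2 * m)} (h : 0 ≤ scalarCurvature (conformalMetric w) x) :
    Laplacian.laplacian w x + ((m : ℝ) - 1) * ∑ k, pd k w x ^ 2 ≤ 0 := by
  rw [scalarCurvature_conformalMetric hw] at h
  have hm' : (1 : ℝ) ≤ m := by exact_mod_cast hm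
  have h1 : 0 < Real.exp (-(2 * w x)) * (((2 * m : ℕ) : ℝ) - 1) := by
    have := Real.exp_pos (-(2 * w x))
    push_cast
    have : (0 : ℝ) < 2 * m - 1 := by linarith
    positivity
  rw [neg_nonneg] at h
  have h2 := nonpos_of_mul_nonpos_right h h1
  push_cast at h2
  linarith

end ScalarCurvature

/-! ### Reduction of the total `Q`-curvature to a Lebesgue integral. -/

section Reduction

variable {m : ℕ}

/-- The iterated operator `(-Δ)^j w`. -/
noncomputable def negLapIter {n : ℕ} (w : Euc n → ℝ) (j : ℕ) : Euc n → ℝ :=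
  (fun f : Euc n → ℝ => -(Laplacian.laplacian f))^[j] w

theorem negLapIter_zero {n : ℕ} (w : Euc n → ℝ) : negLapIter w 0 = w := rfl

theorem negLapIter_succ {n : ℕ} (w : Euc n → ℝ) (j : ℕ) :
    negLapIter w (j + 1) = -(Laplacian.laplacian (negLapIter w j)) :=
  Function.iterate_succ_apply' _ _ _

theorem contDiff_negLapIter {n : ℕ} {w : Euc n → ℝ} (hw : ContDiff ℝ ∞ w) (j : ℕ) :
    ContDiff ℝ ∞ (negLapIter w j) := by
  induction j with
  | zero => exact hw
  | succ j ih => rw [negLapIter_succ]; exact (contDiff_laplacian ih).neg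

theorem sqrt_det_conformalMetric {n : ℕ} (w : Euc n → ℝ) (x : Euc n) :
    Real.sqrt (conformalMetric w x).det = Real.exp (n * w x) := by
  have : (conformalMetric w x).det = Real.exp (n * w x) ^ 2 := by
    rw [conformalMetric, Matrix.det_smul, Matrix.det_one, Fintype.card_fin, mul_one,
      ← Real.exp_nat_mul, ← Real.exp_nat_mul]
    congr 1; push_cast; ring
  rw [this, Real.sqrt_sq (Real.exp_pos _).le]

/-- The density `e^{nw}` of the volume cancels the factor `e^{-nw}` of `Q`. -/
theorem qCurvature_reduction {w : Euc (2 * m) → ℝ} (hw : ContDiff ℝ ∞ w)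
    (hQ : Integrable (qCurvature w) (conformalMetric w).riemannianVolume) :
    Integrable (negLapIter w m) ∧
    ∫ x, qCurvature w x ∂(conformalMetric w).riemannianVolume = ∫ x, negLapIter w m x := by
  have hwc : Continuous w := hw.continuous
  have hvol : (conformalMetric w).riemannianVolume = (volume : Measure (Euc (2 * m))).withDensity
      fun x => ((Real.toNNReal (Real.exp (((2 * m : ℕ) : ℝ) * w x)) : NNReal) : ℝ≥0∞) := by
    unfold MetricField.riemannianVolume
    simp only [sqrt_det_conformalMetric]
    rfl
  have hmeas : Measurable fun x => Real.toNNReal (Real.exp (((2 * m : ℕ) : ℝ) * w x)) := by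
    fun_prop
  have hpt : ∀ x, Real.toNNReal (Real.exp (((2 * m : ℕ) : ℝ) * w x)) • qCurvature w x =
      negLapIter w m x := fun x => by
    rw [NNReal.smul_def, Real.coe_toNNReal _ (Real.exp_pos _).le, smul_eq_mul, qCurvature,
      ← mul_assoc, ← Real.exp_add, neg_mul, add_neg_cancel, Real.exp_zero, one_mul]
    rfl
  rw [hvol] at hQ ⊢
  rw [integrable_withDensity_iff_integrable_smul hmeas] at hQ
  rw [integral_withDensity_eq_integral_smul hmeas]
  simp only [hpt] at hQ ⊢
  exact ⟨hQ, trivial⟩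

end Reduction

/-! ### Logarithmic decay of the spherical means of `w`. -/

section MeanAsymptotics

open MetricField

theorem sphere_measure_pos {n : ℕ} (hn : n ≠ 0) : 0 < (sphereMeasure n).real Set.univ := by
  have : NeZero n := ⟨hn⟩
  rw [measureReal_def, ENNReal.toReal_pos_iff]
  refine ⟨pos_iff_ne_zero.2 ?_, measure_lt_top _ _⟩
  rw [ne_eq, Measure.measure_univ_eq_zero]
  exact Measure.toSphere_ne_zero _

/-- Cauchy-Schwarz against a constant, from `∫ (S h - I)² ≥ 0`. -/
theorem sq_integral_le {n : ℕ} {h : Metric.sphere (0 : Euc n) 1 → ℝ} (hh : Continuous h) :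
    (∫ σ, h σ ∂sphereMeasure n) ^ 2 ≤
      (sphereMeasure n).real Set.univ * ∫ σ, h σ ^ 2 ∂sphereMeasure n := by
  set S := (sphereMeasure n).real Set.univ
  set I := ∫ σ, h σ ∂sphereMeasure n
  have hS : 0 ≤ S := measureReal_nonneg
  have h1 : 0 ≤ ∫ σ, (S * h σ - I) ^ 2 ∂sphereMeasure n :=
    integral_nonneg fun σ => sq_nonneg _
  have h2 : ∫ σ, (S * h σ - I) ^ 2 ∂sphereMeasure n =
      S ^ 2 * (∫ σ, h σ ^ 2 ∂sphereMeasure n) - 2 * S * I * I + S * I ^ 2 := by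
    have e : ∀ σ, (S * h σ - I) ^ 2 = (S ^ 2 * h σ ^ 2 - 2 * S * I * h σ) + I ^ 2 :=
      fun σ => by ring
    simp only [e]
    rw [integral_add (integrable_sphere (by fun_prop)) (integrable_const _),
      integral_sub (integrable_sphere (by fun_prop)) (integrable_sphere (by fun_prop)),
      integral_const_mul, integral_const_mul, integral_const, smul_eq_mul]
  rcases hS.eq_or_lt with h0 | h0
  · have : sphereMeasure n = 0 := by
      rw [← Measure.measure_univ_eq_zero]
      exact (measureReal_eq_zero_iff).1 h0.symm
    simp [I, this]
  · rw [h2] at h1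
    have h3 : S * I ^ 2 ≤ S * (S * ∫ σ, h σ ^ 2 ∂sphereMeasure n) := by nlinarith
    exact le_of_mul_le_mul_left h3 h0

theorem sq_fderiv_le {n : ℕ} (f : Euc n → ℝ) (x : Euc n) {v : Euc n} (hv : ‖v‖ = 1) :
    fderiv ℝ f x v ^ 2 ≤ ∑ k, pd k f x ^ 2 := by
  rw [← sum_mul_pd f x v]
  refine (Finset.sum_mul_sq_le_sq_mul_sq _ _ _).trans ?_
  rw [← EuclideanSpace.real_norm_sq_eq, hv]
  simp

variable {m : ℕ} {w : Euc (2 * m) → ℝ}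

theorem sphInt_neg {n : ℕ} (f : Euc n → ℝ) (r : ℝ) : sphInt (-f) r = -sphInt f r := by
  simp [sphInt, integral_neg]

theorem sphInt_mono_of_norm_eq {n : ℕ} {f g : Euc n → ℝ} (hf : Continuous f) (hg : Continuous g)
    {r : ℝ} (hr : 0 ≤ r) (h : ∀ x, ‖x‖ = r → f x ≤ g x) : sphInt f r ≤ sphInt g r := by
  refine integral_mono (integrable_sphere (by fun_prop)) (integrable_sphere (by fun_prop))
    fun σ => h _ ?_
  have hσ : ‖(σ : Euc n)‖ = 1 := norm_eq_of_mem_sphere σ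
  rw [norm_smul, hσ, mul_one, Real.norm_of_nonneg hr]

/-- The conformal factor satisfies the differential inequality expressing `R_g ≥ 0` off a ball. -/
theorem exists_radius_scal (hm : 1 ≤ m) (hw : ContDiff ℝ ∞ w)
    (hscal : ∀ᶠ x in cocompact (Euc (2 * m)), 0 ≤ (conformalMetric w).scalarCurvature x) :
    ∃ R₀ : ℝ, 1 ≤ R₀ ∧ ∀ x, R₀ ≤ ‖x‖ →
      Laplacian.laplacian w x + ((m : ℝ) - 1) * ∑ k, pd k w x ^ 2 ≤ 0 := by
  rw [← Metric.cobounded_eq_cocompact, hasBasis_cobounded_norm.eventually_iff] at hscal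
  obtain ⟨R, -, hR⟩ := hscal
  refine ⟨max 1 R, le_max_left _ _, fun x hx => ?_⟩
  refine laplacian_add_grad_sq_nonpos hm (contDiff_infty.1 hw 2) (hR ?_)
  exact (le_max_right 1 R).trans hx

/-- The means of `(-Δ)^j w` form the hierarchy. With `S` the area of the unit sphere, its positivity
condition has `κ = (m-1)/S`: on large spheres `(∫ ∂_r w)² ≤ S ∫ |∇w|² ≤ S/(m-1) ∫ (-Δw)`. -/
theorem tendsto_mul_deriv_sphInt (hm : 1 ≤ m) (hw : ContDiff ℝ ∞ w)
    (hscal : ∀ᶠ x in cocompact (Euc (2 * m)), 0 ≤ (conformalMetric w).scalarCurvature x)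
    (hQ : Integrable (negLapIter w m)) :
    Tendsto (fun r => r * deriv (sphInt w) r) atTop
      (𝓝 (-((∫ x, negLapIter w m x) / ((2 * m - 2).doubleFactorial : ℝ) ^ 2))) := by
  have hn : 2 * m ≠ 0 := by omega
  have hs : ∀ j, ContDiff ℝ 2 (negLapIter w j) := fun j =>
    contDiff_infty.1 (contDiff_negLapIter hw j) 2
  refine tendsto_mul_deriv_hierarchy (W := fun j => sphInt (negLapIter w j)) hm
    (fun j _ => continuous_sphInt (hs j).continuous) ?_ ?_ ?_
  · intro j _ r hr
    have h1 := sphInt_hasDerivAt_of_pos hn (hs j) hr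
    have h2 : ∀ s, sphInt (negLapIter w (j + 1)) s =
        -sphInt (Laplacian.laplacian (negLapIter w j)) s := fun s => by
      rw [negLapIter_succ, sphInt_neg]
    simp only [h2, mul_neg, intervalIntegral.integral_neg, neg_div, neg_neg]
    exact h1
  · intro hm2
    obtain ⟨R₀, hR₀, hsc⟩ := exists_radius_scal hm hw hscal
    have hS := sphere_measure_pos hn
    have hm' : (0 : ℝ) < (m : ℝ) - 1 := by
      have : (2 : ℝ) ≤ m := by exact_mod_cast hm2
      linarith
    refine ⟨((m : ℝ) - 1) / (sphereMeasure (2 * m)).real Set.univ, by positivity, ?_⟩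
    filter_upwards [eventually_ge_atTop R₀] with r hr
    have hr0 : 0 ≤ r := by linarith
    have hw1 : ContDiff ℝ 1 w := contDiff_infty.1 hw 1
    have hlap := continuous_laplacian (contDiff_infty.1 hw 2)
    have hfd : Continuous (fderiv ℝ w) := hw1.continuous_fderiv one_ne_zero
    have hpd : ∀ k, Continuous (pd k w) := fun k =>
      (contDiff_pd (k := 0) hw1 (by norm_num) k).continuous
    have e0 : deriv (sphInt (negLapIter w 0)) r = sphFlux w r := (hasDerivAt_sphInt hw1 r).deriv
    rw [e0, negLapIter_succ, negLapIter_zero, sphInt_neg]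
    have h1 := sq_integral_le (h := fun σ : Metric.sphere (0 : Euc (2 * m)) 1 =>
      fderiv ℝ w (r • (σ : Euc (2 * m))) (σ : Euc (2 * m))) (by fun_prop)
    have h2 : ∫ σ : Metric.sphere (0 : Euc (2 * m)) 1,
        (fderiv ℝ w (r • (σ : Euc (2 * m))) (σ : Euc (2 * m))) ^ 2 ∂sphereMeasure (2 * m) ≤
        sphInt (fun x => ∑ k, pd k w x ^ 2) r := by
      refine integral_mono (integrable_sphere (by fun_prop)) (integrable_sphere (by fun_prop))
        fun σ => sq_fderiv_le w _ (norm_eq_of_mem_sphere σ)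
    have h3 := sphInt_mono_of_norm_eq (f := fun x => ((m : ℝ) - 1) * ∑ k, pd k w x ^ 2)
      (g := -(Laplacian.laplacian w)) (by fun_prop) hlap.neg hr0 fun x hx => by
        have := hsc x (hx ▸ hr)
        simp only [Pi.neg_apply]
        linarith
    rw [sphInt_neg] at h3
    have h4 : sphInt (fun x => ((m : ℝ) - 1) * ∑ k, pd k w x ^ 2) r =
        ((m : ℝ) - 1) * sphInt (fun x => ∑ k, pd k w x ^ 2) r := integral_const_mul _ _
    rw [h4] at h3
    refine le_trans ?_ h3
    rw [div_mul_eq_mul_div, div_le_iff₀ hS, mul_assoc]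
    refine mul_le_mul_of_nonneg_left ?_ hm'.le
    rw [mul_comm (sphInt _ _)]
    exact h1.trans (mul_le_mul_of_nonneg_left h2 hS.le)
  · obtain ⟨h1, h2⟩ := integral_polar hn hQ
    rw [h2]
    exact intervalIntegral_tendsto_integral_Ioi 0 h1 tendsto_id

/-- If the total `Q`-curvature exceeds the bound, the spherical means of `w` decay faster than
`-log r`. -/
theorem exists_sphInt_lt_log (hm : 1 ≤ m) (hw : ContDiff ℝ ∞ w)
    (hscal : ∀ᶠ x in cocompact (Euc (2 * m)), 0 ≤ (conformalMetric w).scalarCurvature x)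
    (hQ : Integrable (negLapIter w m))
    (hα : 1 < gaussBonnetConst (2 * m) * ∫ x, negLapIter w m x) :
    ∃ β : ℝ, 1 < β ∧ ∀ᶠ r in atTop,
      sphInt w r < -(β * (sphereMeasure (2 * m)).real Set.univ * Real.log r) := by
  have hn : 2 * m ≠ 0 := by omega
  have hS := sphere_measure_pos hn
  set S := (sphereMeasure (2 * m)).real Set.univ with hS_def
  set a := (∫ x, negLapIter w m x) / ((2 * m - 2).doubleFactorial : ℝ) ^ 2
  have ha : gaussBonnetConst (2 * m) * (∫ x, negLapIter w m x) = a / S := by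
    simp only [gaussBonnetConst, a, S]
    field_simp
  rw [ha] at hα
  obtain ⟨β, hβ1, hβ⟩ := exists_between hα
  refine ⟨β, hβ1, ?_⟩
  have h1 := tendsto_mul_deriv_sphInt hm hw hscal hQ
  have hw1 : ContDiff ℝ 1 w := contDiff_infty.1 hw 1
  -- L'Hôpital's rule against `log r` needs no information on the limit of the numerator.
  have h2 : Tendsto (fun r => sphInt w r / Real.log r) atTop (𝓝 (-a)) := by
    refine tendsto_div_of_deriv_div (f' := deriv (sphInt w)) (g' := fun r => r⁻¹)
      (Eventually.of_forall fun r => (hasDerivAt_sphInt hw1 r).differentiableAt.hasDerivAt)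
      ?_ ?_ Real.tendsto_log_atTop ?_
    · filter_upwards [eventually_gt_atTop 0] with r hr using Real.hasDerivAt_log hr.ne'
    · filter_upwards [eventually_gt_atTop 0] with r hr using inv_pos.2 hr
    · refine h1.congr fun r => ?_
      rw [div_inv_eq_mul, mul_comm]
  have h3 : -a < -(β * S) := by
    rw [lt_div_iff₀ hS] at hβ
    linarith
  filter_upwards [h2.eventually (gt_mem_nhds h3), eventually_gt_atTop 1] with r hr hr1
  have hlog : 0 < Real.log r := Real.log_pos hr1
  rw [div_lt_iff₀ hlog] at hr
  linarith

end MeanAsymptotics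

/-! ### Mean value inequalities for functions superharmonic near infinity. -/

section Superharmonic

open MetricField

variable {n : ℕ}

theorem setIntegral_ball_polar (hn : n ≠ 0) {g : Euc n → ℝ} (hg : Continuous g) {b : ℝ}
    (hb : 0 ≤ b) :
    ∫ x in Metric.ball (0 : Euc n) b, g x = ∫ r in (0 : ℝ)..b, r ^ (n - 1) * sphInt g r := by
  have hi : Integrable ((Metric.ball (0 : Euc n) b).indicator g) := by
    rw [integrable_indicator_iff measurableSet_ball]
    exact (hg.continuousOn.integrableOn_compact (isCompact_closedBall 0 b)).mono_set
      Metric.ball_subset_closedBall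
  have hs : ∀ r, 0 < r → sphInt ((Metric.ball (0 : Euc n) b).indicator g) r =
      (Set.Iio b).indicator (sphInt g) r := fun r hr => by
    have hmem : ∀ σ : Metric.sphere (0 : Euc n) 1,
        r • (σ : Euc n) ∈ Metric.ball (0 : Euc n) b ↔ r ∈ Set.Iio b := fun σ => by
      have hσ : ‖(σ : Euc n)‖ = 1 := norm_eq_of_mem_sphere σ
      rw [mem_ball_zero_iff, norm_smul, hσ, mul_one, Real.norm_of_nonneg hr.le, Set.mem_Iio]
    unfold sphInt
    by_cases h : r ∈ Set.Iio b
    · simp only [Set.indicator_of_mem h, Set.indicator_of_mem ((hmem _).2 h)]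
    · rw [Set.indicator_of_notMem h]
      simp only [Set.indicator_of_notMem (fun h' => h ((hmem _).1 h')), integral_zero]
  rw [← integral_indicator measurableSet_ball, (integral_polar hn hi).2,
    setIntegral_congr_fun measurableSet_Ioi (g := fun r => r ^ (n - 1) *
      (Set.Iio b).indicator (sphInt g) r) fun r hr => by simp only [hs r hr],
    integral_Ioi_eq_of_eq_zero hb fun r hr => by
      rw [Set.indicator_of_notMem (by simpa using hr), mul_zero],
    intervalIntegral.integral_of_le hb, intervalIntegral.integral_of_le hb,
    integral_Ioc_eq_integral_Ioo, integral_Ioc_eq_integral_Ioo]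
  exact setIntegral_congr_fun measurableSet_Ioo fun r hr => by
    simp only [Set.indicator_of_mem (show r ∈ Set.Iio b from hr.2)]

theorem laplacian_translate {f : Euc n → ℝ} (hf : ContDiff ℝ 2 f) (z x : Euc n) :
    Laplacian.laplacian (fun y => f (z + y)) x = Laplacian.laplacian f (z + x) := by
  have h1 : ∀ (f : Euc n → ℝ) (i : Fin n), pd i (fun y => f (z + y)) = fun y => pd i f (z + y) := by
    intro f i
    ext y
    unfold pd
    rw [fderiv_comp_add_left]
  have hfz : ContDiff ℝ 2 fun y => f (z + y) := hf.comp (by fun_prop)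
  rw [laplacian_eq_sum_pd hf, laplacian_eq_sum_pd hfz]
  simp only [h1]

theorem sphInt_zero (f : Euc n → ℝ) : sphInt f 0 = (sphereMeasure n).real Set.univ * f 0 := by
  simp [sphInt]

/-- The mean value inequality for a function superharmonic off a ball. -/
theorem exists_sphInt_translate_le (hn : 3 ≤ n) {f : Euc n → ℝ} (hf : ContDiff ℝ 2 f) {R₀ : ℝ}
    (hR₀ : 0 < R₀) (hsup : ∀ x, R₀ ≤ ‖x‖ → Laplacian.laplacian f x ≤ 0) :
    ∃ C : ℝ, 0 ≤ C ∧ ∀ z, 2 * R₀ ≤ ‖z‖ → ∀ s, 0 ≤ s → sphInt (fun y => f (z + y)) s ≤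
      (sphereMeasure n).real Set.univ * f z + C / ‖z‖ ^ (n - 2) := by
  have hn0 : n ≠ 0 := by omega
  have hlap := continuous_laplacian hf
  -- The positive part of `Δf` has compact support, so its total mass `q` bounds the outward flux
  -- through every sphere.
  set G : Euc n → ℝ := fun x => max (Laplacian.laplacian f x) 0
  have hG : Continuous G := hlap.max continuous_const
  have hGi : Integrable G := hG.integrable_of_hasCompactSupport <| by
    refine HasCompactSupport.intro (isCompact_closedBall (0 : Euc n) R₀) fun x hx => ?_
    rw [mem_closedBall_zero_iff, not_le] at hx
    exact max_eq_right (hsup x hx.le)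
  set q := ∫ x, G x
  have hq : 0 ≤ q := integral_nonneg fun x => le_max_right _ _
  have hn2 : (0 : ℝ) < (n - 2 : ℕ) := by
    have : 0 < n - 2 := by omega
    exact_mod_cast this
  -- The constant comes from integrating the flux bound `q r^{1-n}` over `r ≥ ‖z‖/2`.
  refine ⟨q / (n - 2 : ℕ) * 2 ^ (n - 2), by positivity, fun z hz => ?_⟩
  have hz0 : 0 < ‖z‖ := by linarith
  set h := sphInt fun y => f (z + y)
  have hfz : ContDiff ℝ 2 fun y => f (z + y) := hf.comp (by fun_prop)
  have hlapz : Laplacian.laplacian (fun y => f (z + y)) = fun x => Laplacian.laplacian f (z + x) :=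
    funext fun x => laplacian_translate hf z x
  set F : Euc n → ℝ := fun x => Laplacian.laplacian f (z + x)
  have hF : Continuous F := hlap.comp (by fun_prop)
  set I : ℝ → ℝ := fun r => ∫ s in (0 : ℝ)..r, s ^ (n - 1) * sphInt F s
  have hd : ∀ r, 0 < r → HasDerivAt h (I r / r ^ (n - 1)) r := fun r hr => by
    have := sphInt_hasDerivAt_of_pos hn0 hfz hr
    rwa [hlapz] at this
  have hcF := continuous_sphInt hF
  have hGz : Continuous fun x => G (z + x) := hG.comp (by fun_prop)
  have hcG := continuous_sphInt hGz
  have hI1 : ∀ r, 0 ≤ r → I r ≤ q := fun r hr => by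
    calc I r ≤ ∫ s in (0 : ℝ)..r, s ^ (n - 1) * sphInt (fun x => G (z + x)) s := by
          refine intervalIntegral.integral_mono_on hr (Continuous.intervalIntegrable (by fun_prop) _ _)
            (Continuous.intervalIntegrable (by fun_prop) _ _) fun s hs => ?_
          have hs0 := hs.1
          gcongr
          exact sphInt_mono_of_norm_eq hF hGz hs0 fun x _ => le_max_left _ _
      _ = ∫ x in Metric.ball (0 : Euc n) r, G (z + x) := (setIntegral_ball_polar hn0 hGz hr).symm
      _ ≤ ∫ x, G (z + x) := setIntegral_le_integral (hGi.comp_add_left z)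
          (Eventually.of_forall fun x => le_max_right _ _)
      _ = q := integral_add_left_eq_self G z
  -- Points within `‖z‖/2` of `z` have norm at least `‖z‖/2 ≥ R₀`, so `f` is superharmonic there.
  have hI2 : ∀ r, 0 ≤ r → r ≤ ‖z‖ / 2 → I r ≤ 0 := fun r hr hrz => by
    have : I r ≤ ∫ s in (0 : ℝ)..r, (0 : ℝ) := by
      refine intervalIntegral.integral_mono_on hr (Continuous.intervalIntegrable (by fun_prop) _ _)
        (Continuous.intervalIntegrable (by fun_prop) _ _) fun s hs => ?_
      refine mul_nonpos_of_nonneg_of_nonpos (pow_nonneg hs.1 _) ?_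
      have h1 := sphInt_mono_of_norm_eq hF (g := fun _ => 0) continuous_const hs.1 fun x hx => by
        refine hsup _ ?_
        have := norm_sub_le_norm_add z x
        have := hs.2
        linarith
      simpa [sphInt] using h1
    simpa using this
  have hcont : Continuous h := continuous_sphInt hfz.continuous
  have h0 : h 0 = (sphereMeasure n).real Set.univ * f z := by simp only [h, sphInt_zero, add_zero]
  have hanti1 : AntitoneOn h (Set.Icc 0 (‖z‖ / 2)) := by
    refine antitoneOn_of_hasDerivWithinAt_nonpos (f' := fun r => I r / r ^ (n - 1))
      (convex_Icc _ _) hcont.continuousOn ?_ ?_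
    · intro r hr
      rw [interior_Icc] at hr
      exact (hd r hr.1).hasDerivWithinAt
    · intro r hr
      rw [interior_Icc] at hr
      exact div_nonpos_of_nonpos_of_nonneg (hI2 r hr.1.le hr.2.le) (pow_nonneg hr.1.le _)
  have hanti2 : AntitoneOn (fun r => h r + q / (n - 2 : ℕ) * (r ^ (n - 2))⁻¹)
      (Set.Ici (‖z‖ / 2)) := by
    have hdd : ∀ r, 0 < r → HasDerivAt (fun r => h r + q / (n - 2 : ℕ) * (r ^ (n - 2))⁻¹)
        (I r / r ^ (n - 1) + q / (n - 2 : ℕ) *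
          (-(((n - 2 : ℕ) : ℝ) * r ^ (n - 2 - 1)) / (r ^ (n - 2)) ^ 2)) r := fun r hr =>
      (hd r hr).add (((hasDerivAt_pow (n - 2) r).inv (by positivity)).const_mul _)
    refine antitoneOn_of_hasDerivWithinAt_nonpos (f' := fun r => I r / r ^ (n - 1) +
      q / (n - 2 : ℕ) * (-(((n - 2 : ℕ) : ℝ) * r ^ (n - 2 - 1)) / (r ^ (n - 2)) ^ 2))
      (convex_Ici _) ?_ ?_ ?_
    · intro r hr
      have : 0 < r := lt_of_lt_of_le (by positivity) (Set.mem_Ici.1 hr)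
      exact (hdd r this).continuousAt.continuousWithinAt
    · intro r hr
      rw [interior_Ici] at hr
      have : 0 < r := lt_trans (by positivity) (Set.mem_Ioi.1 hr)
      exact (hdd r this).hasDerivWithinAt
    · intro r hr
      rw [interior_Ici] at hr
      have hr0 : 0 < r := lt_trans (by positivity) (Set.mem_Ioi.1 hr)
      have e : (r ^ (n - 2)) ^ 2 = r ^ (n - 1) * r ^ (n - 2 - 1) := by
        rw [← pow_mul, ← pow_add]; congr 1; omega
      have e2 : I r / r ^ (n - 1) + q / (n - 2 : ℕ) *
          (-(((n - 2 : ℕ) : ℝ) * r ^ (n - 2 - 1)) / (r ^ (n - 2)) ^ 2) =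
          (I r - q) / r ^ (n - 1) := by
        rw [e]
        field_simp
        ring
      simp only [e2]
      exact div_nonpos_of_nonpos_of_nonneg (by linarith [hI1 r hr0.le]) (pow_nonneg hr0.le _)
  intro s hs
  have hz2 : 0 ≤ ‖z‖ / 2 := by positivity
  have hC : q / (n - 2 : ℕ) * 2 ^ (n - 2) / ‖z‖ ^ (n - 2) =
      q / (n - 2 : ℕ) * ((‖z‖ / 2) ^ (n - 2))⁻¹ := by
    rw [div_pow, inv_div, mul_div_assoc]
  rw [hC, ← h0]
  rcases le_total s (‖z‖ / 2) with h1 | h1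
  · have := hanti1 (Set.left_mem_Icc.2 hz2) ⟨hs, h1⟩ hs
    have h3 : 0 ≤ q / (n - 2 : ℕ) * ((‖z‖ / 2) ^ (n - 2))⁻¹ := by positivity
    linarith
  · have h2 := hanti1 (Set.left_mem_Icc.2 hz2) (Set.right_mem_Icc.2 hz2) hz2
    have h3 := hanti2 (Set.mem_Ici.2 le_rfl) (Set.mem_Ici.2 h1) h1
    have h4 : 0 ≤ q / (n - 2 : ℕ) * (s ^ (n - 2))⁻¹ := by positivity
    simp only at h3
    linarith

/-- The integral of a positive superharmonic function over a shell is controlled by its values. -/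
theorem exists_setIntegral_shell_le (hn : 3 ≤ n) {f : Euc n → ℝ} (hf : ContDiff ℝ 2 f)
    (hpos : ∀ x, 0 ≤ f x) {R₀ : ℝ}
    (hR₀ : 0 < R₀) (hsup : ∀ x, R₀ ≤ ‖x‖ → Laplacian.laplacian f x ≤ 0) :
    ∃ C : ℝ, 0 ≤ C ∧ ∀ z, 2 * R₀ ≤ ‖z‖ →
      ∫ x in Metric.ball (0 : Euc n) (2 * ‖z‖), f x ≤ C * ‖z‖ ^ n * (f z + 1 / ‖z‖ ^ (n - 2)) := by
  have hn0 : n ≠ 0 := by omega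
  obtain ⟨C, hC, h⟩ := exists_sphInt_translate_le hn hf hR₀ hsup
  set S := (sphereMeasure n).real Set.univ
  have hS : 0 ≤ S := measureReal_nonneg
  refine ⟨(S + C) * 3 ^ n, by positivity, fun z hz => ?_⟩
  have hz0 : 0 < ‖z‖ := by linarith
  have hfz : Continuous fun y => f (z + y) := hf.continuous.comp (by fun_prop)
  have hcS := continuous_sphInt hfz
  set A := S * f z + C / ‖z‖ ^ (n - 2)
  have hA : 0 ≤ A := by have := hpos z; positivity
  -- The ball is enlarged to one centred at `z`, where polar coordinates and the mean value
  -- inequality apply.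
  calc ∫ x in Metric.ball (0 : Euc n) (2 * ‖z‖), f x
      ≤ ∫ x in Metric.ball z (3 * ‖z‖), f x := by
        refine setIntegral_mono_set ?_ (Eventually.of_forall fun x => hpos x)
          (LE.le.eventuallyLE ?_)
        · exact (hf.continuous.continuousOn.integrableOn_compact
            (isCompact_closedBall z _)).mono_set Metric.ball_subset_closedBall
        · refine Metric.ball_subset_ball' ?_
          rw [dist_zero_left]; linarith
    _ = ∫ x in Metric.ball (0 : Euc n) (3 * ‖z‖), f (z + x) := by
        rw [← integral_indicator measurableSet_ball, ← integral_indicator measurableSet_ball,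
          ← integral_add_left_eq_self _ z]
        refine integral_congr_ae (Eventually.of_forall fun x => ?_)
        simp only [Set.indicator, mem_ball_iff_norm, add_sub_cancel_left, sub_zero]
    _ = ∫ s in (0 : ℝ)..(3 * ‖z‖), s ^ (n - 1) * sphInt (fun y => f (z + y)) s :=
        setIntegral_ball_polar hn0 hfz (by positivity)
    _ ≤ ∫ s in (0 : ℝ)..(3 * ‖z‖), (3 * ‖z‖) ^ (n - 1) * A := by
        refine intervalIntegral.integral_mono_on (by positivity)
          (Continuous.intervalIntegrable (by fun_prop) _ _)
          (Continuous.intervalIntegrable (by fun_prop) _ _) fun s hs => ?_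
        have h1 := hs.1
        have h2 := hs.2
        calc s ^ (n - 1) * sphInt (fun y => f (z + y)) s ≤ s ^ (n - 1) * A := by
              gcongr; exact h z hz s h1
          _ ≤ (3 * ‖z‖) ^ (n - 1) * A := by gcongr
    _ = (3 * ‖z‖) ^ n * A := by
        rw [intervalIntegral.integral_const, sub_zero, smul_eq_mul, ← mul_assoc, ← pow_succ',
          show n - 1 + 1 = n by omega]
    _ ≤ (3 * ‖z‖) ^ n * ((S + C) * (f z + 1 / ‖z‖ ^ (n - 2))) := by
        gcongr
        have h1 : 0 ≤ C * f z := mul_nonneg hC (hpos z)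
        have h2 : 0 ≤ S * (1 / ‖z‖ ^ (n - 2)) := by positivity
        have h3 : C / ‖z‖ ^ (n - 2) = C * (1 / ‖z‖ ^ (n - 2)) := by ring
        simp only [A, h3]
        nlinarith
    _ = (S + C) * 3 ^ n * ‖z‖ ^ n * (f z + 1 / ‖z‖ ^ (n - 2)) := by rw [mul_pow]; ring

end Superharmonic

/-! ### The case `n ≥ 4`: a ray of finite length. -/

section HigherDimension

open MetricField

/-- For `k = m - 1` the bracket is the quantity that `R_g ≥ 0` makes nonpositive, so `e^{(m-1)w}` is
superharmonic near infinity. -/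
theorem laplacian_exp_mul {n : ℕ} {w : Euc n → ℝ} (hw : ContDiff ℝ 2 w) (k : ℝ) (x : Euc n) :
    Laplacian.laplacian (fun y => Real.exp (k * w y)) x =
      k * Real.exp (k * w x) * (Laplacian.laplacian w x + k * ∑ i, pd i w x ^ 2) := by
  have hd : Differentiable ℝ w := hw.differentiable two_ne_zero
  have h1 : ∀ i, pd i (fun y => Real.exp (k * w y)) = fun y => Real.exp (k * w y) * (k * pd i w y) := by
    intro i
    ext y
    unfold pd
    rw [(((hd y).hasFDerivAt.const_mul k).exp).fderiv]
    simp
  have h2 : ∀ i, pd i (fun y => Real.exp (k * w y) * (k * pd i w y)) x =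
      Real.exp (k * w x) * (k * pd i (pd i w) x) +
        (k * pd i w x) * (Real.exp (k * w x) * (k * pd i w x)) := by
    intro i
    have e1 := ((hd x).hasFDerivAt.const_mul k).exp
    have e2 := (((contDiff_pd (k := 1) hw (by norm_num) i).differentiable one_ne_zero
      x).hasFDerivAt).const_mul k
    have e3 := (e1.mul e2).fderiv
    unfold pd at e3 ⊢
    refine (congrArg (fun L => L (EuclideanSpace.single i (1 : ℝ))) e3).trans ?_
    simp
  have hv : ContDiff ℝ 2 fun y => Real.exp (k * w y) := by fun_prop
  rw [laplacian_eq_sum_pd hv, laplacian_eq_sum_pd hw]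
  simp only [h1, h2]
  rw [Finset.mul_sum, ← Finset.sum_add_distrib, Finset.mul_sum]
  refine Finset.sum_congr rfl fun i _ => ?_
  ring

/-- Some point of the sphere of radius `r` carries a value below the mean. -/
theorem exists_le_of_sphInt_lt {n : ℕ} {f : Euc n → ℝ} (hf : Continuous f) {r c : ℝ} (hr : 0 ≤ r)
    (h : sphInt f r < (sphereMeasure n).real Set.univ * c) : ∃ z, ‖z‖ = r ∧ f z ≤ c := by
  by_contra hcon
  push Not at hcon
  have h1 := sphInt_mono_of_norm_eq (f := fun _ => c) continuous_const hf hr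
    fun x hx => (hcon x hx).le
  simp only [sphInt, integral_const, smul_eq_mul] at h1 h
  linarith

variable {m : ℕ} {w : Euc (2 * m) → ℝ}

theorem le_one_add_pow {t : ℝ} (ht : 0 ≤ t) {k : ℕ} (hk : k ≠ 0) : t ≤ 1 + t ^ k := by
  rcases le_total t 1 with h | h
  · have := pow_nonneg ht k
    linarith
  · have := le_self_pow₀ h hk
    linarith

/-- Decay of the integral of `e^w` over balls, when the spherical means of `w` decay. -/
theorem exists_integral_exp_le (hm : 2 ≤ m) (hw : ContDiff ℝ ∞ w) {R₀ : ℝ} (hR₀ : 1 ≤ R₀)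
    (hsc : ∀ x, R₀ ≤ ‖x‖ → Laplacian.laplacian w x + ((m : ℝ) - 1) * ∑ k, pd k w x ^ 2 ≤ 0)
    {β : ℝ} (hβ2 : β ≤ 2)
    (hmean : ∀ᶠ r in atTop,
      sphInt w r < -(β * (sphereMeasure (2 * m)).real Set.univ * Real.log r)) :
    ∃ C : ℝ, 0 ≤ C ∧ ∀ᶠ r in atTop,
      ∫ x in Metric.ball (0 : Euc (2 * m)) (2 * r), Real.exp (w x) ≤
        C * r ^ (2 * m) * r ^ (-β) := by
  set k : ℕ := m - 1
  have hk : k ≠ 0 := by omega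
  have hkm : (k : ℝ) = (m : ℝ) - 1 := by simp only [k]; push_cast [show 1 ≤ m by omega]; ring
  have hn : 3 ≤ 2 * m := by omega
  have hw2 : ContDiff ℝ 2 w := contDiff_infty.1 hw 2
  have hv : ContDiff ℝ 2 fun y => Real.exp (k * w y) := by fun_prop
  obtain ⟨C, hC, hshell⟩ := exists_setIntegral_shell_le hn hv (fun x => (Real.exp_pos _).le)
    (by linarith : 0 < R₀) fun x hx => by
      rw [laplacian_exp_mul hw2, hkm]
      refine mul_nonpos_of_nonneg_of_nonpos ?_ (hsc x hx)
      have : (0 : ℝ) ≤ (m : ℝ) - 1 := by rw [← hkm]; positivity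
      positivity
  set V := (volume : Measure (Euc (2 * m))).real (Metric.ball 0 2)
  refine ⟨V + 2 * C, by positivity, ?_⟩
  filter_upwards [hmean, eventually_ge_atTop (2 * R₀)] with r hr hr2
  have hr1 : 1 ≤ r := by linarith
  have hr0 : 0 < r := by linarith
  obtain ⟨z, hz, hwz⟩ := exists_le_of_sphInt_lt hw.continuous hr0.le
    (c := -(β * Real.log r)) (by linarith)
  have h1 := hshell z (by rw [hz]; exact hr2)
  rw [hz] at h1
  have e1 : Real.exp (k * w z) ≤ (r ^ (-β)) ^ k := by
    rw [Real.rpow_def_of_pos hr0, ← Real.exp_nat_mul]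
    refine Real.exp_le_exp.2 (mul_le_mul_of_nonneg_left ?_ (by positivity))
    linarith
  -- Here `β ≤ 2` enters: the error `r^{2-n} = r^{-2k}` is absorbed by `r^{-βk}`.
  have e2 : 1 / r ^ (2 * m - 2) ≤ (r ^ (-β)) ^ k := by
    rw [show 2 * m - 2 = 2 * k by omega, pow_mul, one_div, ← inv_pow]
    refine pow_le_pow_left₀ (by positivity) ?_ k
    rw [← Real.rpow_natCast r 2, ← Real.rpow_neg hr0.le]
    exact Real.rpow_le_rpow_of_exponent_le hr1 (by push_cast; linarith)
  have hP : 0 < (r ^ (-β)) ^ k := by positivity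
  have hb : 0 < r ^ (-β) := by positivity
  have e3 : ∫ x in Metric.ball (0 : Euc (2 * m)) (2 * r), Real.exp (k * w x) ≤
      C * r ^ (2 * m) * (2 * (r ^ (-β)) ^ k) := by
    refine h1.trans (mul_le_mul_of_nonneg_left ?_ (by positivity))
    linarith
  -- The bound on `e^{kw}` is passed to `e^w` through `t ≤ 1 + t^k` with `t = e^w / r^{-β}`.
  have hptw : ∀ x, Real.exp (w x) ≤ r ^ (-β) + r ^ (-β) * ((r ^ (-β)) ^ k)⁻¹ *
      Real.exp (k * w x) := fun x => by
    have h2 := le_one_add_pow (t := Real.exp (w x) / r ^ (-β)) (by positivity) hk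
    rw [div_pow, ← Real.exp_nat_mul, div_le_iff₀ hb] at h2
    refine h2.trans (le_of_eq ?_)
    ring
  have hcw : Continuous w := hw.continuous
  have hint : ∀ g : Euc (2 * m) → ℝ, Continuous g →
      IntegrableOn g (Metric.ball (0 : Euc (2 * m)) (2 * r)) := fun g hg =>
    (hg.continuousOn.integrableOn_compact
      (isCompact_closedBall 0 (2 * r))).mono_set Metric.ball_subset_closedBall
  have hvol : (volume : Measure (Euc (2 * m))).real (Metric.ball 0 (2 * r)) = r ^ (2 * m) * V := by
    have := (volume : Measure (Euc (2 * m))).addHaar_ball_mul_of_pos (0 : Euc (2 * m)) hr0 2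
    rw [finrank_euclideanSpace_fin] at this
    rw [mul_comm 2 r, measureReal_def, this, ENNReal.toReal_mul,
      ENNReal.toReal_ofReal (by positivity)]
    rfl
  calc ∫ x in Metric.ball (0 : Euc (2 * m)) (2 * r), Real.exp (w x)
      ≤ ∫ x in Metric.ball (0 : Euc (2 * m)) (2 * r), (r ^ (-β) + r ^ (-β) * ((r ^ (-β)) ^ k)⁻¹ *
        Real.exp (k * w x)) :=
        setIntegral_mono (hint _ (by fun_prop)) (hint _ (by fun_prop)) hptw
    _ = r ^ (2 * m) * V * r ^ (-β) + r ^ (-β) * ((r ^ (-β)) ^ k)⁻¹ *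
        ∫ x in Metric.ball (0 : Euc (2 * m)) (2 * r), Real.exp (k * w x) := by
        rw [integral_add (hint _ (by fun_prop)) (hint _ (by fun_prop)), setIntegral_const, hvol,
          smul_eq_mul, integral_const_mul]
    _ ≤ r ^ (2 * m) * V * r ^ (-β) + r ^ (-β) * ((r ^ (-β)) ^ k)⁻¹ *
        (C * r ^ (2 * m) * (2 * (r ^ (-β)) ^ k)) := by gcongr
    _ = (V + 2 * C) * r ^ (2 * m) * r ^ (-β) := by
        field_simp

/-- If `e^w |x|^{1-n}` is integrable near infinity, some ray has finite length. -/
theorem not_isComplete_of_lintegral_lt_top {n : ℕ} (hn : n ≠ 0) {w : Euc n → ℝ} (hw : Continuous w)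
    {R : ℝ} (hR : 0 < R)
    (h : ∫⁻ x in {x : Euc n | R ≤ ‖x‖}, ENNReal.ofReal (Real.exp (w x) / ‖x‖ ^ (n - 1)) < ⊤) :
    ¬ (conformalMetric w).IsComplete := by
  intro hc
  set A := {x : Euc n | R ≤ ‖x‖}
  have hA : MeasurableSet A := measurableSet_le measurable_const measurable_norm
  have hmeas : Measurable fun x : Euc n => ENNReal.ofReal (Real.exp (w x) / ‖x‖ ^ (n - 1)) := by
    have := hw.measurable
    fun_prop
  -- In polar coordinates the weight `‖x‖^{1-n}` cancels the Jacobian, leaving the lengths of the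
  -- rays from radius `R`, integrated over directions. Almost all of them are finite.
  rw [← lintegral_indicator hA, lintegral_polar hn (hmeas.indicator hA)] at h
  have hS : sphereMeasure n ≠ 0 := by
    intro h0
    have h1 := sphere_measure_pos hn
    simp [h0] at h1
  have hfin : ∀ᵐ σ : Metric.sphere (0 : Euc n) 1 ∂sphereMeasure n, (∫⁻ r in Set.Ioi (0 : ℝ), ENNReal.ofReal (r ^ (n - 1)) *
      A.indicator (fun x => ENNReal.ofReal (Real.exp (w x) / ‖x‖ ^ (n - 1)))
        (r • (σ : Euc n))) < ⊤ := by
    refine ae_lt_top ?_ h.ne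
    refine Measurable.lintegral_prod_right' (f := fun p : Metric.sphere (0 : Euc n) 1 × ℝ =>
      ENNReal.ofReal (p.2 ^ (n - 1)) *
      A.indicator (fun x => ENNReal.ofReal (Real.exp (w x) / ‖x‖ ^ (n - 1)))
        (p.2 • (p.1 : Euc n))) ?_
    refine Measurable.mul (by fun_prop) ((hmeas.indicator hA).comp ?_)
    fun_prop
  have : NeBot (ae (sphereMeasure n)) := ae_neBot.2 hS
  obtain ⟨σ, hσfin⟩ := hfin.exists
  have hσ : ‖(σ : Euc n)‖ = 1 := norm_eq_of_mem_sphere σ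
  set M := ∫⁻ r in Set.Ioi (0 : ℝ), ENNReal.ofReal (r ^ (n - 1)) *
      A.indicator (fun x => ENNReal.ofReal (Real.exp (w x) / ‖x‖ ^ (n - 1))) (r • (σ : Euc n))
  have hray : ∀ b, R ≤ b → cdist w (R • (σ : Euc n)) (b • (σ : Euc n)) ≤ M := fun b hb => by
    refine (cdist_le_ray w hσ hb).trans ?_
    calc ∫⁻ t in Set.Icc R b, ENNReal.ofReal (Real.exp (w (t • (σ : Euc n))))
        ≤ ∫⁻ r in Set.Icc R b, ENNReal.ofReal (r ^ (n - 1)) * A.indicator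
          (fun x => ENNReal.ofReal (Real.exp (w x) / ‖x‖ ^ (n - 1))) (r • (σ : Euc n)) := by
          refine setLIntegral_mono' measurableSet_Icc fun r hr => le_of_eq ?_
          have hr0 : 0 < r := hR.trans_le hr.1
          have hnorm : ‖r • (σ : Euc n)‖ = r := by
            rw [norm_smul, hσ, mul_one, Real.norm_of_nonneg hr0.le]
          have hmem : r • (σ : Euc n) ∈ A := by
            change R ≤ ‖r • (σ : Euc n)‖
            rw [hnorm]; exact hr.1
          rw [Set.indicator_of_mem hmem, hnorm, ← ENNReal.ofReal_mul (by positivity)]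
          congr 1
          field_simp
      _ ≤ M := lintegral_mono_set fun r hr => hR.trans_le hr.1
  obtain ⟨R', hR'⟩ := exists_cdist_ge_of_isComplete hw hc (cdist w 0 (R • (σ : Euc n)) + M + 1)
    (by simp [cdist_ne_top hw, hσfin.ne])
  set b := max R R'
  have hb0 : 0 < b := hR.trans_le (le_max_left _ _)
  have h1 := hR' (b • (σ : Euc n)) (by
    rw [norm_smul, hσ, mul_one, Real.norm_of_nonneg hb0.le]; exact le_max_right _ _)
  have h2 : cdist w 0 (b • (σ : Euc n)) ≤ cdist w 0 (R • (σ : Euc n)) + M :=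
    (cdist_triangle w _ (R • (σ : Euc n)) _).trans (by gcongr; exact hray b (le_max_left _ _))
  have h3 := h1.trans h2
  refine absurd h3 (not_le.2 (ENNReal.lt_add_right ?_ one_ne_zero))
  exact ENNReal.add_ne_top.2 ⟨cdist_ne_top hw _ _, hσfin.ne⟩

/-- Dyadic summation over shells. -/
theorem lintegral_shells_lt_top {n : ℕ} (hn : n ≠ 0) {w : Euc n → ℝ} (hw : Continuous w) {C β : ℝ}
    (hC : 0 ≤ C) (hβ : 1 < β) (h : ∀ᶠ r in atTop,
      ∫ x in Metric.ball (0 : Euc n) (2 * r), Real.exp (w x) ≤ C * r ^ n * r ^ (-β)) :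
    ∃ R : ℝ, 0 < R ∧
      ∫⁻ x in {x : Euc n | R ≤ ‖x‖}, ENNReal.ofReal (Real.exp (w x) / ‖x‖ ^ (n - 1)) < ⊤ := by
  obtain ⟨R₁, hR₁⟩ := h.exists_forall_of_atTop
  set R := max R₁ 1
  have hR : 0 < R := lt_of_lt_of_le one_pos (le_max_right _ _)
  refine ⟨R, hR, ?_⟩
  set A : ℕ → Set (Euc n) := fun j => {x | 2 ^ j * R ≤ ‖x‖} ∩ Metric.ball 0 (2 * (2 ^ j * R))
  have hcover : {x : Euc n | R ≤ ‖x‖} ⊆ ⋃ j, A j := by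
    intro x hx
    have hx' : 1 ≤ ‖x‖ / R := by rw [le_div_iff₀ hR, one_mul]; exact hx
    obtain ⟨j, hj1, hj2⟩ := exists_nat_pow_near hx' one_lt_two
    rw [Set.mem_iUnion]
    refine ⟨j, (le_div_iff₀ hR).1 hj1, ?_⟩
    rw [mem_ball_zero_iff]
    rw [div_lt_iff₀ hR, pow_succ] at hj2
    linarith
  -- On the shell of radius `r = 2^j R` the integral is at most `r^{1-n} · C r^{n-β} = C r^{1-β}`, a
  -- geometric sequence in `j` of ratio `q`.
  set q : ℝ := 2 ^ (1 - β)
  have hq0 : 0 ≤ q := by positivity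
  have hq1 : q < 1 := Real.rpow_lt_one_of_one_lt_of_neg one_lt_two (by linarith)
  have hshell : ∀ j, ∫⁻ x in A j, ENNReal.ofReal (Real.exp (w x) / ‖x‖ ^ (n - 1)) ≤
      ENNReal.ofReal (C * R ^ (1 - β) * q ^ j) := by
    intro j
    set r := 2 ^ j * R
    have hrR : R ≤ r := le_mul_of_one_le_left hR.le (one_le_pow₀ one_le_two)
    have hr0 : 0 < r := hR.trans_le hrR
    have hAm : MeasurableSet (A j) :=
      (measurableSet_le measurable_const measurable_norm).inter measurableSet_ball
    have hint : IntegrableOn (fun x => Real.exp (w x) / r ^ (n - 1)) (Metric.ball (0 : Euc n) (2 * r)) :=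
      ((Continuous.continuousOn (by fun_prop)).integrableOn_compact
        (isCompact_closedBall 0 (2 * r))).mono_set Metric.ball_subset_closedBall
    calc ∫⁻ x in A j, ENNReal.ofReal (Real.exp (w x) / ‖x‖ ^ (n - 1))
        ≤ ∫⁻ x in A j, ENNReal.ofReal (Real.exp (w x) / r ^ (n - 1)) := by
          refine setLIntegral_mono' hAm fun x hx => ENNReal.ofReal_le_ofReal ?_
          have : r ≤ ‖x‖ := hx.1
          gcongr
      _ ≤ ∫⁻ x in Metric.ball (0 : Euc n) (2 * r), ENNReal.ofReal (Real.exp (w x) / r ^ (n - 1)) :=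
          lintegral_mono_set Set.inter_subset_right
      _ = ENNReal.ofReal (∫ x in Metric.ball (0 : Euc n) (2 * r), Real.exp (w x) / r ^ (n - 1)) :=
          (ofReal_integral_eq_lintegral_ofReal hint
            (Eventually.of_forall fun x => by positivity)).symm
      _ ≤ ENNReal.ofReal (C * R ^ (1 - β) * q ^ j) := by
          refine ENNReal.ofReal_le_ofReal ?_
          rw [integral_div, div_le_iff₀ (by positivity)]
          refine (hR₁ r ((le_max_left _ _).trans hrR)).trans (le_of_eq ?_)
          have e1 : R ^ (1 - β) * q ^ j = r ^ (1 - β) := by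
            simp only [r, q]
            rw [Real.mul_rpow (by positivity) hR.le, ← Real.rpow_natCast, ← Real.rpow_natCast,
              ← Real.rpow_mul (by norm_num), ← Real.rpow_mul (by norm_num), mul_comm (j : ℝ)]
            ring
          have e2 : r ^ n = r ^ (n - 1) * r := by rw [← pow_succ]; congr 1; omega
          have e3 : r ^ (1 - β) = r * r ^ (-β) := by
            rw [sub_eq_add_neg, Real.rpow_add hr0, Real.rpow_one]
          rw [mul_assoc C (R ^ (1 - β)), e1, e2, e3]
          ring
  calc ∫⁻ x in {x : Euc n | R ≤ ‖x‖}, ENNReal.ofReal (Real.exp (w x) / ‖x‖ ^ (n - 1))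
      ≤ ∫⁻ x in ⋃ j, A j, ENNReal.ofReal (Real.exp (w x) / ‖x‖ ^ (n - 1)) :=
        lintegral_mono_set hcover
    _ ≤ ∑' j, ∫⁻ x in A j, ENNReal.ofReal (Real.exp (w x) / ‖x‖ ^ (n - 1)) := lintegral_iUnion_le _ _
    _ ≤ ∑' j, ENNReal.ofReal (C * R ^ (1 - β) * q ^ j) := ENNReal.tsum_le_tsum hshell
    _ < ⊤ := by
        rw [← ENNReal.ofReal_tsum_of_nonneg (fun j => by positivity)
          ((summable_geometric_of_lt_one hq0 hq1).mul_left _)]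
        exact ENNReal.ofReal_lt_top

theorem not_isComplete_of_two_le (hm : 2 ≤ m) (hw : ContDiff ℝ ∞ w)
    (hscal : ∀ᶠ x in cocompact (Euc (2 * m)), 0 ≤ (conformalMetric w).scalarCurvature x) {β : ℝ}
    (hβ : 1 < β) (hmean : ∀ᶠ r in atTop,
      sphInt w r < -(β * (sphereMeasure (2 * m)).real Set.univ * Real.log r)) :
    ¬ (conformalMetric w).IsComplete := by
  obtain ⟨R₀, hR₀, hsc⟩ := exists_radius_scal (by omega) hw hscal
  -- Lowering `β` to at most `2` weakens the decay but meets the requirement of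
  -- `exists_integral_exp_le`.
  have hmean' : ∀ᶠ r in atTop,
      sphInt w r < -(min β 2 * (sphereMeasure (2 * m)).real Set.univ * Real.log r) := by
    filter_upwards [hmean, eventually_ge_atTop 1] with r hr hr1
    refine hr.trans_le (neg_le_neg ?_)
    have := Real.log_nonneg hr1
    gcongr
    exact min_le_left _ _
  have hβ' : 1 < min β 2 := lt_min hβ one_lt_two
  obtain ⟨C, hC, h⟩ := exists_integral_exp_le hm hw hR₀ hsc (min_le_right _ _) hmean'
  obtain ⟨R, hR, hfin⟩ := lintegral_shells_lt_top (by omega) hw.continuous hC hβ' h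
  exact not_isComplete_of_lintegral_lt_top (by omega) hw.continuous hR hfin

end HigherDimension
open scoped Convolution

/-! ### Cutoff functions with small conformal gradient. -/

section Cutoff

variable {n : ℕ}

/-- The distance from the origin is locally Lipschitz, with constant close to `e^w` at small scales.
-/
theorem abs_toReal_cdist_sub_le {w : Euc n → ℝ} (hw : Continuous w) {x y : Euc n} {C : ℝ}
    (hC : ∀ z ∈ segment ℝ x y, Real.exp (w z) ≤ C) :
    |(cdist w 0 x).toReal - (cdist w 0 y).toReal| ≤ C * dist x y := by
  have hC0 : 0 ≤ C := (Real.exp_pos _).le.trans (hC x (left_mem_segment ℝ x y))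
  have h1 : (cdist w x y).toReal ≤ C * dist x y :=
    ENNReal.toReal_le_of_le_ofReal (by positivity) (cdist_le_segment w x y hC)
  have h2 : ∀ x y, (cdist w 0 x).toReal ≤ (cdist w 0 y).toReal + (cdist w x y).toReal :=
    fun x y => by
    rw [← ENNReal.toReal_add (cdist_ne_top hw _ _) (cdist_ne_top hw _ _), cdist_comm w x y]
    exact ENNReal.toReal_mono (by simp [cdist_ne_top hw]) (cdist_triangle w 0 y x)
  have h3 := h2 x y
  have h4 := h2 y x
  rw [cdist_comm w y x] at h4
  rw [abs_le]
  constructor <;> linarith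

theorem abs_clamp_sub_le (a b : ℝ) : |max 0 (min 1 a) - max 0 (min 1 b)| ≤ |a - b| := by
  refine (abs_max_sub_max_le_max _ _ _ _).trans ?_
  rw [sub_self, abs_zero, max_eq_right (abs_nonneg _)]
  refine (abs_min_sub_min_le_max _ _ _ _).trans ?_
  rw [sub_self, abs_zero, max_eq_right (abs_nonneg _)]

/-- Smooth cutoff functions with small conformal gradient on a complete conformal metric. -/
theorem exists_cutoff {w : Euc n → ℝ} (hw : Continuous w) (hc : (conformalMetric w).IsComplete)
    (R : ℝ) {T : ℝ} (hT : 0 < T) :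
    ∃ η : Euc n → ℝ, ContDiff ℝ 1 η ∧ HasCompactSupport η ∧
      (∀ x ∈ Metric.ball (0 : Euc n) R, η x = 1) ∧ ∀ x, ‖fderiv ℝ η x‖ ≤ Real.exp (w x) / T := by
  obtain ⟨C, hC, hCb⟩ := exists_cdist_le_on_closedBall hw (0 : Euc n) (|R| + 1)
  set ρ : Euc n → ℝ := fun x => (cdist w 0 x).toReal
  have hρ0 : ∀ x, 0 ≤ ρ x := fun x => ENNReal.toReal_nonneg
  -- The bound `2 * T` leaves room for a factor `2` lost in mollification; the other keeps the ball
  -- of radius `|R| + 1` inside `{ρ ≤ T'}`.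
  set T' := max (2 * T) (C * (|R| + 1))
  have hT' : 0 < T' := lt_of_lt_of_le (by positivity) (le_max_left _ _)
  have hρR : ∀ x, ‖x‖ ≤ |R| + 1 → ρ x ≤ T' := fun x hx => by
    have h1 := hCb 0 (by simp; positivity) x (by simpa using hx)
    rw [dist_zero_left] at h1
    refine (ENNReal.toReal_le_of_le_ofReal (by positivity) h1).trans
      (le_trans ?_ (le_max_right _ _))
    gcongr
  obtain ⟨R₂, hR₂⟩ := exists_cdist_ge_of_isComplete hw hc (ENNReal.ofReal (2 * T'))
    ENNReal.ofReal_ne_top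
  have hρ2 : ∀ x, R₂ ≤ ‖x‖ → 2 * T' ≤ ρ x := fun x hx =>
    (ENNReal.ofReal_le_iff_le_toReal (cdist_ne_top hw _ _)).1 (hR₂ x hx)
  -- Equal to `1` where `ρ ≤ T'` and to `0` where `ρ ≥ 2T'`; properness makes the support bounded.
  set η₀ : Euc n → ℝ := fun x => max 0 (min 1 (2 - ρ x / T'))
  have hη₀1 : ∀ x, ‖x‖ ≤ |R| + 1 → η₀ x = 1 := fun x hx => by
    have : ρ x / T' ≤ 1 := by rw [div_le_one hT']; exact hρR x hx
    simp only [η₀]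
    rw [min_eq_left (by linarith), max_eq_right zero_le_one]
  have hη₀0 : ∀ x, R₂ ≤ ‖x‖ → η₀ x = 0 := fun x hx => by
    have : 2 ≤ ρ x / T' := by rw [le_div_iff₀ hT']; exact hρ2 x hx
    simp only [η₀]
    exact max_eq_left ((min_le_right _ _).trans (by linarith))
  have hlip : ∀ x y C', (∀ z ∈ segment ℝ x y, Real.exp (w z) ≤ C') →
      |η₀ x - η₀ y| ≤ C' / T' * dist x y := fun x y C' h => by
    refine (abs_clamp_sub_le _ _).trans ?_
    have h1 := abs_toReal_cdist_sub_le hw h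
    have h2 : (2 - ρ x / T') - (2 - ρ y / T') = -((ρ x - ρ y) / T') := by ring
    rw [h2, abs_neg, abs_div, abs_of_pos hT', div_mul_eq_mul_div]
    gcongr
  -- The mollification scale is small enough for `e^w` to vary by a factor of at most `2` over the
  -- points involved.
  obtain ⟨δ, hδ, hδw⟩ : ∃ δ > 0, ∀ x ∈ Metric.closedBall (0 : Euc n) (|R₂| + 4),
      ∀ y ∈ Metric.closedBall (0 : Euc n) (|R₂| + 4), dist x y < δ → dist (w x) (w y) < Real.log 2 :=
    Metric.uniformContinuousOn_iff.1 ((isCompact_closedBall _ _).uniformContinuousOn_of_continuous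
      hw.continuousOn) _ (Real.log_pos one_lt_two)
  set ε := min (δ / 2) 1
  have hε : 0 < ε := by positivity
  have hexp : ∀ x y, ‖x‖ ≤ |R₂| + 2 → dist y x < 2 * ε → Real.exp (w y) ≤ 2 * Real.exp (w x) := by
    intro x y hx hy
    have h1 : 2 * ε ≤ δ := by linarith [min_le_left (δ / 2) 1]
    have h2 : ε ≤ 1 := min_le_right _ _
    have hyn : ‖y‖ ≤ |R₂| + 4 := by
      have := norm_sub_norm_le y x
      rw [dist_eq_norm] at hy
      linarith
    have h3 := hδw x (by simp; linarith) y (by simpa using hyn) (by rw [dist_comm]; linarith)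
    rw [Real.dist_eq, abs_lt] at h3
    calc Real.exp (w y) ≤ Real.exp (Real.log 2 + w x) := Real.exp_le_exp.2 (by linarith)
      _ = 2 * Real.exp (w x) := by rw [Real.exp_add, Real.exp_log two_pos]
  have hη₀c : Continuous η₀ := by
    refine continuous_iff_continuousAt.2 fun x => ?_
    obtain ⟨C', hC'⟩ := (isCompact_closedBall x 1).bddAbove_image
      (f := fun x => Real.exp (w x)) (by fun_prop)
    have hx : Tendsto (fun y => C' / T' * dist y x) (𝓝 x) (𝓝 0) := by
      have : Continuous fun y => C' / T' * dist y x := by fun_prop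
      simpa using this.tendsto x
    refine tendsto_iff_dist_tendsto_zero.2 (squeeze_zero' (Eventually.of_forall fun y => dist_nonneg)
      ?_ hx)
    filter_upwards [Metric.closedBall_mem_nhds x one_pos] with y hy
    refine hlip y x C' fun z hz => hC' ⟨z, ?_, rfl⟩
    exact (convex_closedBall x 1).segment_subset hy (by simp) hz
  set φ : ContDiffBump (0 : Euc n) := ⟨ε / 2, ε, by positivity, by linarith⟩
  set η : Euc n → ℝ := φ.normed volume ⋆[ContinuousLinearMap.lsmul ℝ ℝ, volume] η₀
  have hφr : φ.rOut = ε := rfl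
  have hηd : ContDiff ℝ 1 η :=
    φ.hasCompactSupport_normed.contDiff_convolution_left _ φ.contDiff_normed
      hη₀c.locallyIntegrable
  have hε1 : ε ≤ 1 := min_le_right _ _
  have hη1 : ∀ x ∈ Metric.ball (0 : Euc n) R, η x = 1 := fun x hx => by
    rw [mem_ball_zero_iff] at hx
    have hxR : ‖x‖ ≤ |R| + 1 := by linarith [le_abs_self R]
    rw [← hη₀1 x hxR]
    refine φ.normed_convolution_eq_right fun y hy => ?_
    rw [hφr, Metric.mem_ball, dist_eq_norm] at hy
    rw [hη₀1 x hxR, hη₀1 y (by linarith [norm_sub_norm_le y x, le_abs_self R])]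
  have hη0 : ∀ x, |R₂| + 1 ≤ ‖x‖ → η x = 0 := fun x hx => by
    have hxR : R₂ ≤ ‖x‖ := by linarith [le_abs_self R₂]
    rw [← hη₀0 x hxR]
    refine φ.normed_convolution_eq_right fun y hy => ?_
    rw [hφr, Metric.mem_ball, dist_comm, dist_eq_norm] at hy
    rw [hη₀0 x hxR, hη₀0 y (by linarith [norm_sub_norm_le x y, le_abs_self R₂])]
  have hηc : HasCompactSupport η := by
    refine HasCompactSupport.intro (isCompact_closedBall (0 : Euc n) (|R₂| + 1)) fun x hx => hη0 x ?_
    rw [mem_closedBall_zero_iff, not_le] at hx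
    exact hx.le
  refine ⟨η, hηd, hηc, hη1, fun x => ?_⟩
  by_cases hx : ‖x‖ ≤ |R₂| + 2
  · refine norm_fderiv_le_of_lip' ℝ (by positivity) ?_
    filter_upwards [Metric.ball_mem_nhds x hε] with y hy
    have hint : ∀ z, Integrable fun t => φ.normed volume t * η₀ (z - t) := fun z =>
      Continuous.integrable_of_hasCompactSupport
        (φ.continuous_normed.mul (by fun_prop)) φ.hasCompactSupport_normed.mul_right
    have e : ∀ z, η z = ∫ t, φ.normed volume t * η₀ (z - t) := fun z => rfl
    rw [e, e, ← integral_sub (hint y) (hint x)]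
    have hTT : 2 * T ≤ T' := le_max_left _ _
    calc ‖∫ t, φ.normed volume t * η₀ (y - t) - φ.normed volume t * η₀ (x - t)‖
        ≤ ∫ t, φ.normed volume t * (Real.exp (w x) / T * ‖y - x‖) := by
          refine norm_integral_le_of_norm_le (φ.integrable_normed.mul_const _)
            (Eventually.of_forall fun t => ?_)
          rw [← mul_sub, norm_mul, Real.norm_of_nonneg (φ.nonneg_normed t)]
          by_cases ht : t ∈ Metric.ball (0 : Euc n) ε
          · refine mul_le_mul_of_nonneg_left ?_ (φ.nonneg_normed t)
            have h1 := hlip (y - t) (x - t) (2 * Real.exp (w x)) fun z hz => by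
              refine hexp x z hx ?_
              have hxy : y - t ∈ Metric.ball x (2 * ε) := by
                rw [Metric.mem_ball, dist_eq_norm] at hy ⊢
                rw [mem_ball_zero_iff] at ht
                calc ‖y - t - x‖ = ‖(y - x) - t‖ := by congr 1; abel
                  _ ≤ ‖y - x‖ + ‖t‖ := norm_sub_le _ _
                  _ < 2 * ε := by linarith
              have hxx : x - t ∈ Metric.ball x (2 * ε) := by
                rw [mem_ball_zero_iff] at ht
                rw [Metric.mem_ball, dist_eq_norm, sub_sub_cancel_left, norm_neg]
                linarith
              exact (convex_ball x (2 * ε)).segment_subset hxy hxx hz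
            rw [Real.norm_eq_abs]
            refine h1.trans ?_
            rw [dist_sub_right, dist_eq_norm]
            refine mul_le_mul_of_nonneg_right ?_ (norm_nonneg _)
            rw [div_le_div_iff₀ hT' hT]
            nlinarith [Real.exp_pos (w x)]
          · have : φ.normed volume t = 0 := by
              have h1 : t ∉ Function.support (φ.normed volume) := by
                rw [φ.support_normed_eq]; exact ht
              simpa using h1
            simp [this]
      _ = Real.exp (w x) / T * ‖y - x‖ := by
          rw [integral_mul_const, φ.integral_normed, one_mul]
  · have h0 : η =ᶠ[𝓝 x] fun _ => 0 := by
      have hopen : IsOpen {y : Euc n | |R₂| + 1 < ‖y‖} := isOpen_lt continuous_const continuous_norm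
      filter_upwards [hopen.mem_nhds (show |R₂| + 1 < ‖x‖ by linarith)] with y hy
      exact hη0 y (le_of_lt hy)
    rw [h0.fderiv_eq]
    simp
    positivity

end Cutoff

/-! ### Caccioppoli's inequality and a Liouville property. -/

section Caccioppoli

open MetricField

variable {n : ℕ}

theorem hasDerivAt_max_zero_sq (t : ℝ) :
    HasDerivAt (fun s : ℝ => max s 0 ^ 2) (2 * max t 0) t := by
  rcases lt_trichotomy t 0 with h | rfl | h
  · have h1 : (fun s : ℝ => max s 0 ^ 2) =ᶠ[𝓝 t] fun _ => 0 := by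
      filter_upwards [Iio_mem_nhds h] with s hs
      rw [max_eq_right (le_of_lt hs)]; simp
    rw [max_eq_right h.le, mul_zero]
    exact (hasDerivAt_const t (0 : ℝ)).congr_of_eventuallyEq h1
  · rw [max_self, mul_zero, hasDerivAt_iff_isLittleO]
    simp only [max_self, sub_zero, smul_zero]
    have h1 : (fun s : ℝ => s ^ 2) =o[𝓝 0] fun s : ℝ => s := by
      simpa using Asymptotics.isLittleO_pow_pow (𝕜 := ℝ) (m := 1) (n := 2) (by norm_num)
    refine Asymptotics.IsBigO.trans_isLittleO (Asymptotics.IsBigO.of_bound 1 ?_) h1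
    refine Eventually.of_forall fun s => ?_
    have h2 : max s 0 ^ 2 ≤ s ^ 2 := by
      rcases le_total s 0 with h | h
      · rw [max_eq_right h]; nlinarith
      · rw [max_eq_left h]
    simpa using h2
  · have h1 : (fun s : ℝ => max s 0 ^ 2) =ᶠ[𝓝 t] fun s => s ^ 2 := by
      filter_upwards [Ioi_mem_nhds h] with s hs
      rw [max_eq_left (le_of_lt hs)]
    rw [max_eq_left h.le]
    refine HasDerivAt.congr_of_eventuallyEq ?_ h1
    simpa using hasDerivAt_pow 2 t

/-- The square of the positive part, unlike the positive part itself, is regular enough to be tested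
in Green's identity. -/
theorem contDiff_max_zero_sq : ContDiff ℝ 1 fun s : ℝ => max s 0 ^ 2 := by
  rw [contDiff_one_iff_deriv]
  refine ⟨fun t => (hasDerivAt_max_zero_sq t).differentiableAt, ?_⟩
  have : deriv (fun s : ℝ => max s 0 ^ 2) = fun t => 2 * max t 0 :=
    funext fun t => (hasDerivAt_max_zero_sq t).deriv
  rw [this]
  fun_prop

theorem pd_mul {f g : Euc n → ℝ} {x : Euc n} (hf : DifferentiableAt ℝ f x)
    (hg : DifferentiableAt ℝ g x) (i : Fin n) :
    pd i (fun y => f y * g y) x = f x * pd i g x + g x * pd i f x := by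
  simp [pd, fderiv_fun_mul hf hg]

theorem pd_comp {G : ℝ → ℝ} {G' : ℝ} {f : Euc n → ℝ} {x : Euc n} (hG : HasDerivAt G G' (f x))
    (hf : DifferentiableAt ℝ f x) (i : Fin n) :
    pd i (fun y => G (f y)) x = G' * pd i f x := by
  have := (hG.comp_hasFDerivAt x hf.hasFDerivAt).fderiv
  unfold pd
  rw [show (fun y => G (f y)) = G ∘ f from rfl, this]
  simp

/-- Caccioppoli's inequality for the positive part of a function which is subharmonic
where `χ > 0`. -/
theorem integral_caccioppoli_le {u χ η : Euc n → ℝ} (hu : ContDiff ℝ 2 u) (hχ : ContDiff ℝ 1 χ)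
    (hη : ContDiff ℝ 1 η) (hηc : HasCompactSupport η) (hχ0 : ∀ x, 0 ≤ χ x)
    (hsub : ∀ x, 0 < χ x → 0 ≤ Laplacian.laplacian u x)
    (hχu : ∀ x, 0 < u x → fderiv ℝ χ x = 0) :
    ∫ x, η x ^ 2 * (χ x * max (u x) 0 * ∑ i, pd i u x ^ 2) ≤
      ∫ x, χ x * max (u x) 0 ^ 3 * ∑ i, pd i η x ^ 2 := by
  have hu1 : ContDiff ℝ 1 u := hu.of_le (by norm_num)
  have cu := hu1.continuous
  have cχ := hχ.continuous
  have cη := hη.continuous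
  have cpd : ∀ {f : Euc n → ℝ}, ContDiff ℝ 1 f → ∀ i, Continuous (pd i f) := fun h i =>
    (contDiff_pd (k := 0) h (by norm_num) i).continuous
  have cpu := cpd hu1
  have cpη := cpd hη
  have hp : ContDiff ℝ 1 fun x => max (u x) 0 ^ 2 := contDiff_max_zero_sq.comp hu1
  -- Test function `η² χ u₊²`. Its gradient has no contribution from `∇χ`, which vanishes where `u >
  -- 0`.
  set φ : Euc n → ℝ := fun x => η x * (η x * (χ x * max (u x) 0 ^ 2))
  have hφ : ContDiff ℝ 1 φ := hη.mul (hη.mul (hχ.mul hp))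
  have hφc : HasCompactSupport φ := hηc.mul_right
  have hφ0 : ∀ x, 0 ≤ φ x := fun x => by
    have : φ x = η x ^ 2 * (χ x * max (u x) 0 ^ 2) := by simp only [φ]; ring
    rw [this]
    have := hχ0 x
    positivity
  have hpd : ∀ i x, pd i φ x = 2 * η x * pd i η x * (χ x * max (u x) 0 ^ 2) +
      η x ^ 2 * χ x * (2 * max (u x) 0 * pd i u x) := fun i x => by
    have d1 := hη.differentiable one_ne_zero x
    have d2 := hχ.differentiable one_ne_zero x
    have d3 := hp.differentiable one_ne_zero x
    have d4 : DifferentiableAt ℝ (fun y => χ y * max (u y) 0 ^ 2) x := d2.mul d3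
    have d5 : DifferentiableAt ℝ (fun y => η y * (χ y * max (u y) 0 ^ 2)) x := d1.mul d4
    simp only [φ]
    rw [pd_mul d1 d5, pd_mul d1 d4, pd_mul d2 d3,
      pd_comp (hasDerivAt_max_zero_sq (u x)) (hu1.differentiable one_ne_zero x)]
    have h0 : max (u x) 0 ^ 2 * pd i χ x = 0 := by
      rcases le_or_gt (u x) 0 with h | h
      · simp [max_eq_right h]
      · simp [pd, hχu x h]
    linear_combination η x ^ 2 * h0
  have hgreen := integral_mul_laplacian hu hφ hφc
  have hnn : 0 ≤ ∫ x, φ x * Laplacian.laplacian u x := integral_nonneg fun x => by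
    rcases (hχ0 x).eq_or_lt with h | h
    · simp [φ, ← h]
    · exact mul_nonneg (hφ0 x) (hsub x h)
  have cφi : ∀ i, Continuous (pd i φ) := cpd hφ
  have hφic : ∀ i, HasCompactSupport (pd i φ) := fun i => hφc.fderiv_apply (𝕜 := ℝ) _
  have hηic : ∀ i, HasCompactSupport (pd i η) := fun i => hηc.fderiv_apply (𝕜 := ℝ) _
  have I1 : Integrable fun x => ∑ i, pd i φ x * pd i u x :=
    integrable_finsetSum _ fun i _ =>
      ((cφi i).mul (cpu i)).integrable_of_hasCompactSupport (hφic i).mul_right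
  have I2 : Integrable fun x => χ x * max (u x) 0 ^ 3 * ∑ i, pd i η x ^ 2 := by
    simp only [Finset.mul_sum]
    refine integrable_finsetSum _ fun i _ => ?_
    have := hηic i
    refine Continuous.integrable_of_hasCompactSupport (by have := cpη i; fun_prop) ?_
    have h2 : HasCompactSupport fun x => pd i η x * (pd i η x) := (hηic i).mul_right
    simp only [sq]
    exact h2.mul_left
  have I3 : Integrable fun x => η x ^ 2 * (χ x * max (u x) 0 * ∑ i, pd i u x ^ 2) := by
    refine Continuous.integrable_of_hasCompactSupport (by fun_prop) ?_
    have h2 : HasCompactSupport fun x => η x * η x := hηc.mul_right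
    simp only [sq]
    exact h2.mul_right
  have key : ∫ x, η x ^ 2 * (χ x * max (u x) 0 * ∑ i, pd i u x ^ 2) ≤
      ∫ x, ((∑ i, pd i φ x * pd i u x) + χ x * max (u x) 0 ^ 3 * ∑ i, pd i η x ^ 2) := by
    refine integral_mono I3 (I1.add I2) fun x => ?_
    simp only [Finset.mul_sum, ← Finset.sum_add_distrib]
    refine Finset.sum_le_sum fun i _ => ?_
    rw [hpd]
    have hχx := hχ0 x
    -- This square is exactly the difference of the two integrands in the `i`-th coordinate.
    have : 0 ≤ χ x * max (u x) 0 * (η x * pd i u x + max (u x) 0 * pd i η x) ^ 2 := by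
      positivity
    linarith [this]
  rw [integral_add I1 I2] at key
  linarith

theorem abs_pd_le (f : Euc n → ℝ) (x : Euc n) (i : Fin n) : |pd i f x| ≤ ‖fderiv ℝ f x‖ := by
  have := (fderiv ℝ f x).le_opNorm (EuclideanSpace.single i 1)
  simpa [pd] using this

/-- Liouville property of complete conformal metrics. -/
theorem mul_max_zero_sq_eq_of_isComplete {w u χ F : Euc n → ℝ} (hw : Continuous w)
    (hc : (conformalMetric w).IsComplete) (hu : ContDiff ℝ 2 u) (hχ : ContDiff ℝ 1 χ)
    (hχ0 : ∀ x, 0 ≤ χ x) (hsub : ∀ x, 0 < χ x → 0 ≤ Laplacian.laplacian u x)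
    (hχu : ∀ x, 0 < u x → fderiv ℝ χ x = 0) (hF : Integrable F)
    (hFle : ∀ x, χ x * max (u x) 0 ^ 3 * Real.exp (2 * w x) ≤ F x) (x y : Euc n) :
    χ x * max (u x) 0 ^ 2 = χ y * max (u y) 0 ^ 2 := by
  have hu1 : ContDiff ℝ 1 u := hu.of_le (by norm_num)
  have cu := hu1.continuous
  have cχ := hχ.continuous
  have cpu : ∀ i, Continuous (pd i u) := fun i =>
    (contDiff_pd (k := 0) hu1 (by norm_num) i).continuous
  set f : Euc n → ℝ := fun x => χ x * max (u x) 0 * ∑ i, pd i u x ^ 2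
  have cf : Continuous f := by fun_prop
  have hf0 : ∀ x, 0 ≤ f x := fun x => by have := hχ0 x; positivity
  have hF0 : ∀ x, 0 ≤ F x := fun x => le_trans (by have := hχ0 x; positivity) (hFle x)
  -- For cutoffs with `|∇η| ≤ e^w / T` the right side of Caccioppoli's inequality is `O(T⁻²)`. With
  -- `R` fixed and `T → ∞`, the function `f` must vanish.
  have hbound : ∀ R T : ℝ, 0 < T →
      ∫ x in Metric.ball 0 R, f x ≤ (n * ∫ x, F x) / T ^ 2 := fun R T hT => by
    obtain ⟨η, hη, hηc, hη1, hηd⟩ := exists_cutoff hw hc R hT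
    have cη := hη.continuous
    have hI : Integrable fun x => η x ^ 2 * f x := by
      refine Continuous.integrable_of_hasCompactSupport (by fun_prop) ?_
      have h2 : HasCompactSupport fun x => η x * η x := hηc.mul_right
      simp only [sq]
      exact h2.mul_right
    calc ∫ x in Metric.ball 0 R, f x = ∫ x in Metric.ball 0 R, η x ^ 2 * f x :=
          setIntegral_congr_fun measurableSet_ball fun x hx => by simp [hη1 x hx]
      _ ≤ ∫ x, η x ^ 2 * f x :=
          setIntegral_le_integral hI (Eventually.of_forall fun x =>
            mul_nonneg (sq_nonneg _) (hf0 x))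
      _ ≤ ∫ x, χ x * max (u x) 0 ^ 3 * ∑ i, pd i η x ^ 2 :=
          integral_caccioppoli_le hu hχ hη hηc hχ0 hsub hχu
      _ ≤ ∫ x, n / T ^ 2 * F x := by
          refine integral_mono_of_nonneg (Eventually.of_forall fun x => ?_) (hF.const_mul _)
            (Eventually.of_forall fun x => ?_)
          · have := hχ0 x
            simp only [Pi.zero_apply]; positivity
          · have h1 : ∑ i, pd i η x ^ 2 ≤ ∑ _i : Fin n, (Real.exp (w x) / T) ^ 2 :=
              Finset.sum_le_sum fun i _ =>
                sq_le_sq' (by linarith [neg_abs_le (pd i η x), abs_pd_le η x i, hηd x])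
                  (by linarith [le_abs_self (pd i η x), abs_pd_le η x i, hηd x])
            have h2 : ∑ _i : Fin n, (Real.exp (w x) / T) ^ 2 =
                n / T ^ 2 * Real.exp (2 * w x) := by
              rw [two_mul, Real.exp_add]
              simp; ring
            rw [h2] at h1
            have h3 : 0 ≤ χ x * max (u x) 0 ^ 3 := by have := hχ0 x; positivity
            calc χ x * max (u x) 0 ^ 3 * ∑ i, pd i η x ^ 2
                ≤ χ x * max (u x) 0 ^ 3 * (n / T ^ 2 * Real.exp (2 * w x)) := by gcongr
              _ = n / T ^ 2 * (χ x * max (u x) 0 ^ 3 * Real.exp (2 * w x)) := by ring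
              _ ≤ n / T ^ 2 * F x := by gcongr; exact hFle x
      _ = _ := by rw [integral_const_mul]; ring
  have hfR : ∀ R : ℝ, ∫ x in Metric.ball 0 R, f x ≤ 0 := fun R => by
    have ht : Tendsto (fun T : ℝ => (n * ∫ x, F x) / T ^ 2) atTop (𝓝 0) :=
      (tendsto_pow_atTop two_ne_zero).const_div_atTop _
    exact ge_of_tendsto ht (by filter_upwards [eventually_gt_atTop 0] with T hT using hbound R T hT)
  have hfz : ∀ x, f x = 0 := fun x => by
    set B : Set (Euc n) := Metric.ball 0 (‖x‖ + 1)
    have hint : IntegrableOn f B :=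
      (cf.continuousOn.integrableOn_compact (isCompact_closedBall _ _)).mono_set
        Metric.ball_subset_closedBall
    have h1 : ∫ x in B, f x = 0 := le_antisymm (hfR _) (integral_nonneg hf0)
    have h2 := (integral_eq_zero_iff_of_nonneg hf0 hint).1 h1
    exact Measure.eqOn_open_of_ae_eq h2 Metric.isOpen_ball cf.continuousOn continuousOn_const
      (by simp : x ∈ Metric.ball (0 : Euc n) (‖x‖ + 1))
  have hp : ContDiff ℝ 1 fun x => max (u x) 0 ^ 2 := contDiff_max_zero_sq.comp hu1
  -- The gradient is `u₊² ∇χ + 2 χ u₊ ∇u`: the first term vanishes by `hχu`, the second because `f =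
  -- 0`.
  refine is_const_of_fderiv_eq_zero (𝕜 := ℝ) (f := fun x => χ x * max (u x) 0 ^ 2)
    ((hχ.mul hp).differentiable one_ne_zero) (fun x => ?_) x y
  ext v
  rw [← sum_mul_pd]
  refine Finset.sum_eq_zero fun i _ => ?_
  rw [pd_mul (hχ.differentiable one_ne_zero x) (hp.differentiable one_ne_zero x),
    pd_comp (hasDerivAt_max_zero_sq (u x)) (hu1.differentiable one_ne_zero x)]
  have h0 : max (u x) 0 ^ 2 * pd i χ x = 0 := by
    rcases le_or_gt (u x) 0 with h | h
    · simp [max_eq_right h]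
    · simp [pd, hχu x h]
  have h1 : χ x * (2 * max (u x) 0 * pd i u x) = 0 := by
    rcases mul_eq_zero.1 (hfz x) with h | h
    · linear_combination 2 * pd i u x * h
    · have := (Finset.sum_eq_zero_iff_of_nonneg fun i _ => sq_nonneg (pd i u x)).1 h i
        (Finset.mem_univ i)
      rw [pow_eq_zero_iff two_ne_zero] at this
      simp [this]
  rw [h0, h1]; simp

end Caccioppoli

/-! ### The case `n = 2`: a lower bound for `w` on complete planes. -/

section Dim2

open MetricField

variable {n : ℕ}

/-- A smooth function asymptotic to `log ‖x‖`; it is superharmonic away from the origin in the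
plane. -/
noncomputable def regLog (x : Euc n) : ℝ :=
  Real.log (1 + ‖x‖ ^ 2) / 2 - (1 + ‖x‖ ^ 2)⁻¹

theorem contDiff_regLog : ContDiff ℝ ∞ (regLog (n := n)) := by
  have h : ContDiff ℝ ∞ fun x : Euc n => 1 + ‖x‖ ^ 2 := contDiff_const.add (contDiff_norm_sq ℝ)
  have h0 : ∀ x : Euc n, 1 + ‖x‖ ^ 2 ≠ 0 := fun x => by positivity
  exact ((h.log h0).div_const 2).sub (h.inv h0)

theorem pd_one_add_norm_sq (i : Fin n) (x : Euc n) :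
    pd i (fun y : Euc n => 1 + ‖y‖ ^ 2) x = 2 * x i := by
  have := pd_comp_norm_sq (G := fun t => 1 + t) (G' := fun _ => 1)
    (fun t => (hasDerivAt_id t).const_add 1) i x
  simpa using this

/-- The term `log(1 + ‖x‖²)/2` alone has positive Laplacian `2/(1 + ‖x‖²)²`; the subtracted inverse
reverses the sign once `‖x‖² > 3`. -/
theorem laplacian_regLog (hn : n = 2) (x : Euc n) :
    Laplacian.laplacian regLog x = (6 - 2 * ‖x‖ ^ 2) / (1 + ‖x‖ ^ 2) ^ 3 := by
  have hq : ContDiff ℝ ∞ fun x : Euc n => 1 + ‖x‖ ^ 2 := contDiff_const.add (contDiff_norm_sq ℝ)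
  have hqd : ∀ x, DifferentiableAt ℝ (fun x : Euc n => 1 + ‖x‖ ^ 2) x :=
    hq.differentiable (by norm_num)
  have h1 : ∀ i, pd i (regLog (n := n)) =
      fun y => (1 / (1 + ‖y‖ ^ 2) + 2 / (1 + ‖y‖ ^ 2) ^ 2) * y i := fun i => funext fun y => by
    have h0 : 1 + ‖y‖ ^ 2 ≠ 0 := by positivity
    have hd : HasDerivAt (fun t : ℝ => Real.log t / 2 - t⁻¹)
        ((1 + ‖y‖ ^ 2)⁻¹ / 2 - -((1 + ‖y‖ ^ 2) ^ 2)⁻¹) (1 + ‖y‖ ^ 2) :=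
      ((Real.hasDerivAt_log h0).div_const 2).sub (hasDerivAt_inv h0)
    have := pd_comp (G := fun t : ℝ => Real.log t / 2 - t⁻¹) hd (hqd y) i
    rw [pd_one_add_norm_sq] at this
    refine this.trans ?_
    field_simp
    ring
  have h2 : ∀ i, pd i (pd i (regLog (n := n))) x =
      (1 / (1 + ‖x‖ ^ 2) + 2 / (1 + ‖x‖ ^ 2) ^ 2) +
        (-2 / (1 + ‖x‖ ^ 2) ^ 2 - 8 / (1 + ‖x‖ ^ 2) ^ 3) * x i ^ 2 := fun i => by
    have h0 : 1 + ‖x‖ ^ 2 ≠ 0 := by positivity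
    have hd : HasDerivAt (fun t : ℝ => 1 / t + 2 / t ^ 2)
        (-1 / (1 + ‖x‖ ^ 2) ^ 2 - 4 / (1 + ‖x‖ ^ 2) ^ 3) (1 + ‖x‖ ^ 2) := by
      have a := hasDerivAt_inv h0
      have b := ((hasDerivAt_pow (𝕜 := ℝ) 2 (1 + ‖x‖ ^ 2)).fun_inv (pow_ne_zero 2 h0)).const_mul 2
      have e : (fun t : ℝ => 1 / t + 2 / t ^ 2) = fun t => t⁻¹ + 2 * (t ^ 2)⁻¹ := by
        funext t; rw [one_div, div_eq_mul_inv]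
      rw [e]
      refine (a.fun_add b).congr_deriv ?_
      push_cast
      field_simp
      ring
    have e1 := pd_comp (G := fun t : ℝ => 1 / t + 2 / t ^ 2) hd (hqd x) i
    rw [pd_one_add_norm_sq] at e1
    have e2 : pd i (fun y : Euc n => y i) x = 1 := by
      have : HasFDerivAt (fun y : Euc n => y i) (EuclideanSpace.proj i : Euc n →L[ℝ] ℝ) x :=
        (EuclideanSpace.proj i : Euc n →L[ℝ] ℝ).hasFDerivAt
      unfold pd
      rw [this.fderiv]
      simp
    have d1 : DifferentiableAt ℝ
        (fun y : Euc n => 1 / (1 + ‖y‖ ^ 2) + 2 / (1 + ‖y‖ ^ 2) ^ 2) x :=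
      hd.differentiableAt.comp (f := fun y : Euc n => 1 + ‖y‖ ^ 2) x (hqd x)
    have d2 : DifferentiableAt ℝ (fun y : Euc n => y i) x :=
      (EuclideanSpace.proj i : Euc n →L[ℝ] ℝ).differentiableAt
    rw [h1 i, pd_mul d1 d2, e1, e2]
    ring
  rw [laplacian_eq_sum_pd (contDiff_infty.1 contDiff_regLog 2)]
  have h0 : 1 + ‖x‖ ^ 2 ≠ 0 := by positivity
  simp only [h2, Finset.sum_add_distrib, ← Finset.mul_sum]
  have h3 : ∑ i, x i ^ 2 = ‖x‖ ^ 2 := by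
    rw [EuclideanSpace.norm_sq_eq]; simp
  have hn' : (n : ℝ) = 2 := by exact_mod_cast hn
  rw [h3]
  simp only [Finset.sum_const, Finset.card_univ, Fintype.card_fin, nsmul_eq_mul, hn']
  field_simp
  ring

/-- On a complete conformal plane of nonnegative curvature near infinity, the conformal factor
decays at most like `‖x‖ ^ (-β)` for every `β > 1`. -/
theorem exists_log_le_of_isComplete (hn : n = 2) {w : Euc n → ℝ} (hw : ContDiff ℝ ∞ w)
    (hc : (conformalMetric w).IsComplete) {R₀ : ℝ}
    (hscal : ∀ x, R₀ ≤ ‖x‖ → Laplacian.laplacian w x ≤ 0) {β : ℝ} (hβ : 1 < β) :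
    ∃ c R : ℝ, ∀ x, R ≤ ‖x‖ → -c - β * (Real.log (1 + ‖x‖ ^ 2) / 2) ≤ w x := by
  -- Beyond `S ≥ 2` both `w` and `regLog` are superharmonic.
  set S := max |R₀| 2
  have hS2 : 2 ≤ S := le_max_right _ _
  have hSR : R₀ ≤ S := (le_abs_self _).trans (le_max_left _ _)
  set χ : Euc n → ℝ := fun x => Real.smoothTransition (‖x‖ ^ 2 - S ^ 2)
  have hχ : ContDiff ℝ 1 χ :=
    Real.smoothTransition.contDiff.comp ((contDiff_norm_sq ℝ).sub contDiff_const)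
  have hχ1 : ∀ x, S + 1 ≤ ‖x‖ → χ x = 1 := fun x hx =>
    Real.smoothTransition.one_of_one_le (by nlinarith)
  have hχ0 : ∀ x, ‖x‖ ≤ S → χ x = 0 := fun x hx =>
    Real.smoothTransition.zero_of_nonpos (by nlinarith [norm_nonneg x])
  have hlc := (contDiff_regLog (n := n)).continuous
  -- Subtracting `c` makes `u ≤ 0` on the ball where `χ` varies, so `χ` is locally constant on `{u >
  -- 0}`.
  obtain ⟨c, hcb⟩ : ∃ c, ∀ x ∈ Metric.closedBall (0 : Euc n) (S + 1), -w x - β * regLog x ≤ c := by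
    obtain ⟨c, hcb⟩ := (isCompact_closedBall (0 : Euc n) (S + 1)).bddAbove_image
      (f := fun x => -w x - β * regLog x) (by have := hw.continuous; fun_prop)
    exact ⟨c, fun x hx => hcb (Set.mem_image_of_mem _ hx)⟩
  set u : Euc n → ℝ := fun x => -w x - β * regLog x - c with hu_def
  have hus : ContDiff ℝ ∞ u := ((hw.neg.sub (contDiff_const.mul contDiff_regLog)).sub contDiff_const)
  have hlap : ∀ x, Laplacian.laplacian u x =
      -Laplacian.laplacian w x - β * Laplacian.laplacian regLog x := fun x => by
    have h1 : ∀ {f : Euc n → ℝ}, ContDiff ℝ ∞ f → ∀ x, DifferentiableAt ℝ f x := fun h x =>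
      h.differentiable (by norm_num) x
    have hpd : ∀ {f g : Euc n → ℝ} (b : ℝ), ContDiff ℝ ∞ f → ContDiff ℝ ∞ g → ∀ (c : ℝ) (i : Fin n),
        pd i (fun x => -f x - b * g x - c) = fun x => -pd i f x - b * pd i g x - 0 :=
      fun {f g} b hf hg c i => funext fun y => by
        have a1 := (((h1 hf y).hasFDerivAt.fun_neg.fun_sub
          ((h1 hg y).hasFDerivAt.const_mul b)).sub_const c).fderiv
        unfold pd
        rw [a1]; simp
    rw [laplacian_eq_sum_pd (contDiff_infty.1 hus 2), laplacian_eq_sum_pd (contDiff_infty.1 hw 2),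
      laplacian_eq_sum_pd (contDiff_infty.1 contDiff_regLog 2), ← Finset.sum_neg_distrib,
      Finset.mul_sum, ← Finset.sum_sub_distrib]
    refine Finset.sum_congr rfl fun i _ => ?_
    rw [hu_def, hpd β hw contDiff_regLog c i, hpd β (contDiff_pd (l := ∞) hw le_rfl i)
      (contDiff_pd (l := ∞) contDiff_regLog le_rfl i) 0 i]
    simp
  have hball : ∀ x, 0 < u x → S + 1 < ‖x‖ := fun x hx => by
    by_contra h
    have := hcb x (by simpa using not_lt.1 h)
    simp only [u] at hx
    linarith
  -- The majorant `F` comes from `u³ ≤ e^{2u}` for `u > 0`, together with `2u + 2w = -2β regLog -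
  -- 2c`. It is integrable in the plane because `2β > 2`.
  have hmain := mul_max_zero_sq_eq_of_isComplete (u := u) (χ := χ)
    (F := fun x => Real.exp (2 * β - 2 * c) * (1 + ‖x‖ ^ 2) ^ (-(2 * β) / 2)) hw.continuous hc
    (contDiff_infty.1 hus 2) hχ (fun x => Real.smoothTransition.nonneg _)
    (fun x hx => by
      have hxS : S < ‖x‖ := by
        by_contra h
        rw [hχ0 x (not_lt.1 h)] at hx
        exact lt_irrefl _ hx
      have h1 := hscal x (hSR.trans hxS.le)
      rw [hlap, laplacian_regLog hn]
      have h2 : (6 - 2 * ‖x‖ ^ 2) / (1 + ‖x‖ ^ 2) ^ 3 ≤ 0 :=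
        div_nonpos_of_nonpos_of_nonneg (by nlinarith) (by positivity)
      nlinarith)
    (fun x hx => by
      have h1 : χ =ᶠ[𝓝 x] fun _ => (1 : ℝ) := by
        filter_upwards [continuous_norm.continuousAt.eventually (lt_mem_nhds (hball x hx))] with y hy
          using hχ1 y hy.le
      rw [h1.fderiv_eq]; simp)
    ((integrable_rpow_neg_one_add_norm_sq (by simp [hn]; linarith)).const_mul _)
    (fun x => by
      have hq : 0 < 1 + ‖x‖ ^ 2 := by positivity
      rcases le_or_gt (u x) 0 with h | h
      · rw [max_eq_right h]; simp; positivity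
      rw [max_eq_left h.le]
      have h1 : χ x ≤ 1 := Real.smoothTransition.le_one _
      have h2 : u x ^ 3 ≤ Real.exp (2 * u x) := by
        have := Real.pow_div_factorial_le_exp (2 * u x) (by linarith) 3
        refine le_trans ?_ this
        have : 0 < u x ^ 3 := by positivity
        simp [Nat.factorial]
        nlinarith
      have h3 : 2 * u x + 2 * w x ≤ 2 * β - 2 * c + Real.log (1 + ‖x‖ ^ 2) * (-(2 * β) / 2) := by
        have h4 : (1 + ‖x‖ ^ 2)⁻¹ ≤ 1 := inv_le_one_of_one_le₀ (by nlinarith [sq_nonneg ‖x‖])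
        simp only [u, regLog]
        nlinarith
      have h0 : 0 ≤ u x ^ 3 := by positivity
      calc χ x * u x ^ 3 * Real.exp (2 * w x) ≤ 1 * Real.exp (2 * u x) * Real.exp (2 * w x) := by
            gcongr
        _ = Real.exp (2 * u x + 2 * w x) := by rw [Real.exp_add]; ring
        _ ≤ _ := by
          rw [Real.rpow_def_of_pos hq, ← Real.exp_add]
          exact Real.exp_le_exp.2 h3)
  refine ⟨c, S + 1, fun x hx => ?_⟩
  -- At the origin `χ` vanishes, so the constant value of `χ u₊²` is zero.
  have h1 := hmain x 0
  rw [hχ1 x hx, hχ0 0 (by simp; linarith)] at h1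
  have h2 : u x ≤ 0 := by
    have : max (u x) 0 = 0 := by simpa using h1
    exact max_eq_right_iff.1 this
  have h3 : 0 ≤ (1 + ‖x‖ ^ 2)⁻¹ := by positivity
  simp only [u, regLog] at h2
  nlinarith

/-- Completeness would give a pointwise lower bound with an exponent `γ` strictly between `1` and
`β`; averaged over large spheres it contradicts the decay of the means. -/
theorem not_isComplete_of_eq_two (hn : n = 2) {w : Euc n → ℝ} (hw : ContDiff ℝ ∞ w) {R₀ : ℝ}
    (hscal : ∀ x, R₀ ≤ ‖x‖ → Laplacian.laplacian w x ≤ 0) {β : ℝ} (hβ : 1 < β)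
    (hmean : ∀ᶠ r in atTop,
      sphInt w r < -(β * (sphereMeasure n).real Set.univ * Real.log r)) :
    ¬ (conformalMetric w).IsComplete := fun hc => by
  obtain ⟨γ, hγ1, hγ⟩ := exists_between hβ
  obtain ⟨c, R, h⟩ := exists_log_le_of_isComplete hn hw hc hscal hγ1
  have hσ : 0 < (sphereMeasure n).real Set.univ := sphere_measure_pos (by omega)
  have hlog : Tendsto (fun r => (β - γ) * Real.log r) atTop atTop :=
    Real.tendsto_log_atTop.const_mul_atTop (by linarith)
  obtain ⟨r, h1, hr1, hrR, h2⟩ := (hmean.and ((eventually_ge_atTop 1).and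
    ((eventually_ge_atTop R).and (hlog.eventually_gt_atTop (c + γ * (Real.log 2 / 2)))))).exists
  have h3 : sphInt (n := n) (fun _ => -c - γ * (Real.log 2 / 2 + Real.log r)) r ≤ sphInt w r := by
    refine sphInt_mono_of_norm_eq continuous_const hw.continuous (by linarith) fun x hx => ?_
    refine le_trans ?_ (h x (by linarith))
    have h4 : Real.log (1 + ‖x‖ ^ 2) ≤ Real.log 2 + 2 * Real.log r := by
      rw [hx, ← Real.log_rpow (by linarith), ← Real.log_mul (by norm_num) (by positivity)]
      refine Real.log_le_log (by positivity) ?_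
      rw [Real.rpow_two]; nlinarith
    nlinarith
  have h5 : sphInt (n := n) (fun _ => -c - γ * (Real.log 2 / 2 + Real.log r)) r =
      (sphereMeasure n).real Set.univ * (-c - γ * (Real.log 2 / 2 + Real.log r)) := by
    simp [sphInt]
  rw [h5] at h3
  nlinarith

end Dim2

/-! ### Conclusion. -/

theorem mainTheorem3 (m : ℕ) (hm : 1 ≤ m) (w : Euc (2 * m) → ℝ) (hw : ContDiff ℝ ∞ w)
    (hcomplete : (conformalMetric w).IsComplete)
    (hscal : ∀ᶠ x in cocompact (Euc (2 * m)), 0 ≤ (conformalMetric w).scalarCurvature x)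
    (hQ : Integrable (qCurvature w) (conformalMetric w).riemannianVolume) :
    gaussBonnetConst (2 * m) *
      ∫ x, qCurvature w x ∂(conformalMetric w).riemannianVolume ≤ 1 := by
  by_contra! h
  obtain ⟨hI, he⟩ := qCurvature_reduction hw hQ
  rw [he] at h
  obtain ⟨β, hβ, hmean⟩ := exists_sphInt_lt_log hm hw hscal hI h
  rcases hm.eq_or_lt with h1 | h2
  · obtain ⟨R₀, -, hR₀⟩ := exists_radius_scal hm hw hscal
    refine not_isComplete_of_eq_two (by omega) hw (R₀ := R₀) (fun x hx => ?_) hβ hmean hcomplete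
    -- For `m = 1` the coefficient `m - 1` of the gradient term is zero.
    have := hR₀ x hx
    simpa [← h1] using this
  · exact not_isComplete_of_two_le h2 hw hscal hβ hmean hcomplete
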